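/- Let $\mathsf G=(\mathsf V,\mathsf E)$ be a finite simple oriented graph, i.e. $\mathsf V$ is finite, $\mathsf E\subset \mathsf V\times\mathsf V$, $(v,v)\notin\mathsf E$, and $(v,w)\in\mathsf E$ implies $(w,v)\notin \mathsf E$; let $\rho:\mathsf E\to(0,\infty)$. Identify each edge $e=(v,w)$ with the interval $(0,\rho(e))$, its initial endpoint $v$ with $0$ and its terminal endpoint $w$ with $\rho(e)$. Let $L^2(\mathfrak G):=\prod_{e\in\mathsf E}L^2((0,\rho(e));\mathbb C)$ be the Hilbert product of the edge spaces. Consider for families $u=(u_e)_{e\in \mathsf E}$ (identified with their continuous representatives whenever boundary values are taken) the conditions (Cc) there is $d\in\mathbb C^{\mathsf V}$ with $u_e(0)=d(v)$ and $u_e(\rho(e))=d(w)$ for every $e=(v,w)\in\mathsf E$; (Kc) $\displaystyle\sum_{e=(w,v)\in\mathsf E}u_e'(\rho(e))-\sum_{e=(v,w)\in\mathsf E}u_e'(0)=0$ for every $v\in\mathsf V$. Let $A=-\Delta_{cont}$ be the operator $(u_e)\mapsto(-u_e'')$ in $L^2(\mathfrak G)$ with domain $$\Big\{u\in\prod_{e}W^{2,2}(0,\rho(e)):\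 u\text{ satisfies (Cc) and }u_e'(0)=u_e'(\rho(e))=0\text{ for all }e\Big\},$$ and let $A_F$ be the operator $(u_e)\mapsto(-u_e'')$ with domain $$\Big\{u\in\prod_{e}W^{2,2}(0,\rho(e)):\ u\text{ satisfies (Cc) and (Kc)}\Big\}.$$ Then $A_F$ is the Friedrichs extension of $A$. That is: $A$ is densely defined, symmetric and positive semidefinite; $A_F$ is a positive semidefinite self-adjoint extension of $A$; and every positive semidefinite self-adjoint extension $\tilde A$ of $A$ satisfies $\tilde A\le A_F$, where $A_1\le A_2$ means that the closed positive semidefinite forms $a_1,a_2$ with which $A_1,A_2$ are associated satisfy $\mathrm{Dom}(a_2)\subset \mathrm{Dom}(a_1)$ and $a_1(u,u)\le a_2(u,u)$ for all $u\in \mathrm{Dom}(a_2)$. Moreover, the closure of the form $(u,v)\mapsto(Au\mid v)_{L^2(\mathfrak G)}$, $u,v\in\mathrm{Dom}(A)$, is the form $$a_F(u,v)=\sum_{e\in\mathsf E}\int_0^{\rho(e)}u_e'\,\overline{v_e'}\,dx,\qquad u,v\in W^{1,2}(\mathfrak G):=\Big\{w\in\prod_eW^{1,2}(0,\rho(e)):\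 w\text{ satisfies (Cc)}\Big\},$$ and $A_F$ is the operator associated with $a_F$: $u\in\mathrm{Dom}(A_F)$ and $A_Fu=g$ if and only if $u\in W^{1,2}(\mathfrak G)$ and $a_F(u,w)=(g\mid w)_{L^2(\mathfrak G)}$ for all $w\in W^{1,2}(\mathfrak G)$. -/

import Mathlib

open MeasureTheory Set Filter Topology
open scoped ContDiff InnerProductSpace

noncomputable section

/-! ### Unbounded operators and densely defined sesquilinear forms on a Hilbert space -/

section Forms

variable {H : Type*} [NormedAddCommGroup H] [InnerProductSpace ℂ H]

/-- A sesquilinear form `a` whose domain is a linear subspace of `H`; `a u v` is linear in `u` and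
conjugate-linear in `v`. -/
structure SesqForm (H : Type*) [NormedAddCommGroup H] [InnerProductSpace ℂ H] where
  domain : Submodule ℂ H
  toFun : domain →ₗ[ℂ] domain →ₗ⋆[ℂ] ℂ

namespace SesqForm

/-- The form is symmetric and positive semidefinite. -/
def IsPositive (a : SesqForm H) : Prop :=
  (∀ u v, a.toFun u v = starRingEnd ℂ (a.toFun v u)) ∧ ∀ u, 0 ≤ (a.toFun u u).re

/-- A (positive) form is closed if every sequence of its domain which converges in `H` and is Cauchy
for the form has its limit in the domain and converges to it for the form; that is, if the
domain is complete for the norm `u ↦ (a(u,u) + ‖u‖²)^(1/2)`. -/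
def IsClosed (a : SesqForm H) : Prop :=
  ∀ (x : ℕ → a.domain) (u : H), Tendsto (fun n => (x n : H)) atTop (𝓝 u) →
    (∀ ε : ℝ, 0 < ε → ∃ N, ∀ m, N ≤ m → ∀ n, N ≤ n →
      (a.toFun (x m - x n) (x m - x n)).re < ε) →
    ∃ h : u ∈ a.domain, Tendsto (fun n => a.toFun (x n - ⟨u, h⟩) (x n - ⟨u, h⟩)) atTop (𝓝 0)

/-- `b` is the closure of the positive form `a`: it is a closed positive extension of `a`, and the
domain of `a` is dense in that of `b` for the form norm of `b`. -/
def IsClosureOf (b a : SesqForm H) : Prop :=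
  b.IsPositive ∧ b.IsClosed ∧ ∃ h : a.domain ≤ b.domain,
    (∀ u v : a.domain,
      b.toFun (Submodule.inclusion h u) (Submodule.inclusion h v) = a.toFun u v) ∧
    ∀ u : b.domain, ∃ x : ℕ → a.domain,
      Tendsto (fun n => (x n : H)) atTop (𝓝 (u : H)) ∧
      Tendsto (fun n => b.toFun (Submodule.inclusion h (x n) - u)
        (Submodule.inclusion h (x n) - u)) atTop (𝓝 0)

/-- `A` is the operator associated with the form `a`: one has `u ∈ Dom(A)` and `A u = g` if and only
if `u` lies in the domain of `a` and `(g | w) = a(u, w)` for all `w` in the domain of `a`.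
(Mathlib's inner product is conjugate-linear in its first argument: `(g | w) = inner ℂ w g`.) -/
def IsAssociated (a : SesqForm H) (A : H →ₗ.[ℂ] H) : Prop :=
  ∀ u g : H, (u, g) ∈ A.graph ↔
    ∃ hu : u ∈ a.domain, ∀ w : a.domain, inner ℂ (w : H) g = a.toFun ⟨u, hu⟩ w

end SesqForm

namespace LinearPMap

/-- The operator is symmetric and positive semidefinite. -/
def IsPosSemidef (A : H →ₗ.[ℂ] H) : Prop :=
  (∀ u v : A.domain, inner ℂ (A u) (v : H) = inner ℂ (u : H) (A v)) ∧
    ∀ u : A.domain, 0 ≤ (inner ℂ (A u) (u : H)).re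

/-- The form `(u, v) ↦ (A u | v)` on `Dom(A)`. -/
def toForm (A : H →ₗ.[ℂ] H) : SesqForm H where
  domain := A.domain
  toFun := LinearMap.mk₂'ₛₗ (RingHom.id ℂ) (starRingEnd ℂ)
    (fun u v => inner ℂ (v : H) (A u))
    (fun u u' v => by rw [LinearPMap.map_add, inner_add_right])
    (fun c u v => by rw [LinearPMap.map_smul, inner_smul_right]; rfl)
    (fun u v v' => inner_add_left _ _ _)
    (fun c u v => inner_smul_left _ _ _)

/-- The natural order of positive semidefinite self-adjoint operators: `A₁ ≤ A₂` in the sense of the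
associated closed forms, that is, `Dom(a₂) ⊆ Dom(a₁)` and `a₁(u,u) ≤ a₂(u,u)` on `Dom(a₂)`. -/
def FormLE (A₁ A₂ : H →ₗ.[ℂ] H) : Prop :=
  ∃ a₁ a₂ : SesqForm H,
    (a₁.IsPositive ∧ a₁.IsClosed ∧ Dense (a₁.domain : Set H) ∧ a₁.IsAssociated A₁) ∧
    (a₂.IsPositive ∧ a₂.IsClosed ∧ Dense (a₂.domain : Set H) ∧ a₂.IsAssociated A₂) ∧
    ∃ h : a₂.domain ≤ a₁.domain, ∀ u : a₂.domain,
      (a₁.toFun (Submodule.inclusion h u) (Submodule.inclusion h u)).re ≤ (a₂.toFun u u).re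

/-- `B` is the Friedrichs extension of the densely defined, symmetric, positive semidefinite
operator `A`: the largest positive semidefinite self-adjoint extension of `A`. -/
structure IsFriedrichsExtension [CompleteSpace H] (A B : H →ₗ.[ℂ] H) : Prop where
  dense : Dense (A.domain : Set H)
  posSemidef : A.IsPosSemidef
  le : A ≤ B
  isSelfAdjoint : IsSelfAdjoint B
  posSemidef' : B.IsPosSemidef
  largest : ∀ C : H →ₗ.[ℂ] H, A ≤ C → IsSelfAdjoint C → C.IsPosSemidef → FormLE C B

end LinearPMap

end Forms

/-! ### Weak derivatives and boundary values on an interval `(0, ℓ)` -/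

/-- `L²(0, ℓ)`, complex-valued. -/
abbrev IntervalL2 (ℓ : ℝ) : Type :=
  Lp ℂ 2 (volume.restrict (Ioo 0 ℓ))

/-- `g` is the weak derivative of `f` in `(0, ℓ)`, both in `L²(0, ℓ)`. -/
def HasWeakDeriv {ℓ : ℝ} (f g : IntervalL2 ℓ) : Prop :=
  ∀ φ : ℝ → ℝ, ContDiff ℝ ∞ φ → HasCompactSupport φ → tsupport φ ⊆ Ioo 0 ℓ →
    ∫ x in Ioo 0 ℓ, deriv φ x • f x = - ∫ x in Ioo 0 ℓ, φ x • g x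

/-- `f` has a representative `F` that is continuous on `[0, ℓ]` with `F 0 = a` and `F ℓ = b`. Every
element of `W^{1,2}(0, ℓ)` has exactly one pair of boundary values. -/
def HasBoundaryValues {ℓ : ℝ} (f : IntervalL2 ℓ) (a b : ℂ) : Prop :=
  ∃ F : ℝ → ℂ, ContinuousOn F (Icc 0 ℓ) ∧ f =ᵐ[volume.restrict (Ioo 0 ℓ)] F ∧ F 0 = a ∧ F ℓ = b

theorem integrable_test_smul {ℓ : ℝ} (f : IntervalL2 ℓ) {φ : ℝ → ℝ} (hφ : Continuous φ)
    (hc : HasCompactSupport φ) : Integrable (fun x => φ x • f x) (volume.restrict (Ioo 0 ℓ)) := by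
  obtain ⟨C, hC⟩ := hc.exists_bound_of_continuous hφ
  have hf : Integrable f (volume.restrict (Ioo 0 ℓ)) := (Lp.memLp f).integrable (by norm_num)
  exact hf.bdd_smul C hφ.aestronglyMeasurable (Eventually.of_forall hC)

theorem HasWeakDeriv.add {ℓ : ℝ} {f g f' g' : IntervalL2 ℓ} (h : HasWeakDeriv f g)
    (h' : HasWeakDeriv f' g') : HasWeakDeriv (f + f') (g + g') := by
  intro φ hφ hc hs
  have hd : Continuous (deriv φ) := hφ.continuous_deriv (by simp)
  have e1 : ∫ x in Ioo 0 ℓ, deriv φ x • (f + f' : IntervalL2 ℓ) x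
      = ∫ x in Ioo 0 ℓ, (deriv φ x • f x + deriv φ x • f' x) := by
    apply integral_congr_ae
    filter_upwards [Lp.coeFn_add f f'] with x hx
    rw [hx, Pi.add_apply, smul_add]
  have e2 : ∫ x in Ioo 0 ℓ, φ x • (g + g' : IntervalL2 ℓ) x
      = ∫ x in Ioo 0 ℓ, (φ x • g x + φ x • g' x) := by
    apply integral_congr_ae
    filter_upwards [Lp.coeFn_add g g'] with x hx
    rw [hx, Pi.add_apply, smul_add]
  rw [e1, e2, integral_add (integrable_test_smul f hd hc.deriv) (integrable_test_smul f' hd hc.deriv),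
    integral_add (integrable_test_smul g hφ.continuous hc)
      (integrable_test_smul g' hφ.continuous hc), h φ hφ hc hs, h' φ hφ hc hs]
  ring

theorem HasWeakDeriv.smul {ℓ : ℝ} {f g : IntervalL2 ℓ} (c : ℂ) (h : HasWeakDeriv f g) :
    HasWeakDeriv (c • f) (c • g) := by
  intro φ hφ hc hs
  have e1 : ∫ x in Ioo 0 ℓ, deriv φ x • (c • f : IntervalL2 ℓ) x
      = ∫ x in Ioo 0 ℓ, c • (deriv φ x • f x) := by
    apply integral_congr_ae
    filter_upwards [Lp.coeFn_smul c f] with x hx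
    rw [hx, Pi.smul_apply, smul_comm]
  have e2 : ∫ x in Ioo 0 ℓ, φ x • (c • g : IntervalL2 ℓ) x
      = ∫ x in Ioo 0 ℓ, c • (φ x • g x) := by
    apply integral_congr_ae
    filter_upwards [Lp.coeFn_smul c g] with x hx
    rw [hx, Pi.smul_apply, smul_comm]
  rw [e1, e2, integral_smul, integral_smul, h φ hφ hc hs, smul_neg]

theorem hasWeakDeriv_zero {ℓ : ℝ} : HasWeakDeriv (0 : IntervalL2 ℓ) 0 := by
  intro φ _ _ _
  have h0 : ∀ ψ : ℝ → ℝ, ∫ x in Ioo 0 ℓ, ψ x • (0 : IntervalL2 ℓ) x = 0 := by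
    intro ψ
    rw [← integral_zero ℝ ℂ (μ := volume.restrict (Ioo 0 ℓ))]
    apply integral_congr_ae
    filter_upwards [Lp.coeFn_zero ℂ 2 (volume.restrict (Ioo 0 ℓ))] with x hx
    rw [hx, Pi.zero_apply, smul_zero]
  rw [h0, h0, neg_zero]

theorem HasWeakDeriv.unique {ℓ : ℝ} {f g g' : IntervalL2 ℓ} (h : HasWeakDeriv f g)
    (h' : HasWeakDeriv f g') : g = g' := by
  have hz : HasWeakDeriv (0 : IntervalL2 ℓ) (g - g') := by
    have := h.add (h'.smul (-1))
    simpa [← sub_eq_add_neg] using this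
  rw [← sub_eq_zero]
  apply Lp.ext
  have hint : Integrable (g - g' : IntervalL2 ℓ) (volume.restrict (Ioo 0 ℓ)) :=
    (Lp.memLp (g - g')).integrable (by norm_num)
  have key := isOpen_Ioo.ae_eq_zero_of_integral_contDiff_smul_eq_zero (μ := volume)
    (U := Ioo (0 : ℝ) ℓ) (f := (g - g' : IntervalL2 ℓ))
    (IntegrableOn.locallyIntegrableOn hint) (by
      intro φ hφ hc hs
      have h1 := hz φ hφ hc hs
      have h2 : ∫ x in Ioo 0 ℓ, deriv φ x • (0 : IntervalL2 ℓ) x = 0 := by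
        rw [← integral_zero ℝ ℂ (μ := volume.restrict (Ioo 0 ℓ))]
        apply integral_congr_ae
        filter_upwards [Lp.coeFn_zero ℂ 2 (volume.restrict (Ioo 0 ℓ))] with x hx
        rw [hx, Pi.zero_apply, smul_zero]
      rw [h2] at h1
      rw [← setIntegral_eq_integral_of_forall_compl_eq_zero (s := Ioo 0 ℓ)]
      · exact neg_eq_zero.mp h1.symm
      · intro x hx
        rw [image_eq_zero_of_notMem_tsupport (fun hx' => hx (hs hx')), zero_smul])
  filter_upwards [(ae_restrict_iff' measurableSet_Ioo).2 key,
    Lp.coeFn_zero ℂ 2 (volume.restrict (Ioo 0 ℓ))] with x hx hx0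
  rw [hx, hx0, Pi.zero_apply]

theorem HasBoundaryValues.add {ℓ : ℝ} {f f' : IntervalL2 ℓ} {a b a' b' : ℂ}
    (h : HasBoundaryValues f a b) (h' : HasBoundaryValues f' a' b') :
    HasBoundaryValues (f + f') (a + a') (b + b') := by
  obtain ⟨F, hF, hf, rfl, rfl⟩ := h
  obtain ⟨F', hF', hf', rfl, rfl⟩ := h'
  refine ⟨F + F', hF.add hF', ?_, rfl, rfl⟩
  filter_upwards [Lp.coeFn_add f f', hf, hf'] with x h1 h2 h3
  rw [h1, Pi.add_apply, Pi.add_apply, h2, h3]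

theorem HasBoundaryValues.smul {ℓ : ℝ} {f : IntervalL2 ℓ} {a b : ℂ} (c : ℂ)
    (h : HasBoundaryValues f a b) : HasBoundaryValues (c • f) (c * a) (c * b) := by
  obtain ⟨F, hF, hf, rfl, rfl⟩ := h
  refine ⟨fun x => c * F x, continuousOn_const.mul hF, ?_, rfl, rfl⟩
  filter_upwards [Lp.coeFn_smul c f, hf] with x h1 h2
  rw [h1, Pi.smul_apply, h2, smul_eq_mul]

theorem hasBoundaryValues_zero {ℓ : ℝ} : HasBoundaryValues (0 : IntervalL2 ℓ) 0 0 :=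
  ⟨0, continuousOn_const, Lp.coeFn_zero ℂ 2 _, rfl, rfl⟩

/-! ### Metric graphs and their Laplacians -/

/-- A metric graph with node set `V` and finitely many edges over a simple oriented graph: an edge
`e = (v, w)` has initial endpoint `v`, terminal endpoint `w`, and is identified with the interval
`(0, length e)`, where `v` corresponds to `0` and `w` to `length e`. -/
structure MetricGraph (V : Type*) where
  edges : Finset (V × V)
  loopless : ∀ v, (v, v) ∉ edges
  oriented : ∀ v w, (v, w) ∈ edges → (w, v) ∉ edges
  length : edges → ℝ
  length_pos : ∀ e, 0 < length e

namespace MetricGraph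

variable {V : Type*} (G : MetricGraph V)

/-- `L²(𝔊) = ∏ₑ L²(0, ρ(e))`. -/
abbrev L2 : Type _ := PiLp 2 (fun e : G.edges => IntervalL2 (G.length e))

open Classical in
/-- The positive part of the incidence matrix. -/
def incPlus (v : V) (e : G.edges) : ℂ := if v = e.1.2 then 1 else 0

open Classical in
/-- The negative part of the incidence matrix. -/
def incMinus (v : V) (e : G.edges) : ℂ := if v = e.1.1 then 1 else 0

/-- The edgewise weak derivative `(uₑ) ↦ (uₑ')` in `L²(𝔊)` with domain `∏ₑ W^{1,2}(0, ρ(e))`. -/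
def D : G.L2 →ₗ.[ℂ] G.L2 where
  domain :=
    { carrier := {u | ∃ g : G.L2, ∀ e, HasWeakDeriv (u e) (g e)}
      add_mem' := by
        rintro u v ⟨g, hg⟩ ⟨k, hk⟩
        exact ⟨g + k, fun e => (hg e).add (hk e)⟩
      zero_mem' := ⟨0, fun e => hasWeakDeriv_zero⟩
      smul_mem' := by
        rintro c u ⟨g, hg⟩
        exact ⟨c • g, fun e => (hg e).smul c⟩ }
  toFun :=
    { toFun := fun u => u.2.choose
      map_add' := fun u v => PiLp.ext fun e => HasWeakDeriv.unique ((u + v).2.choose_spec e)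
        ((u.2.choose_spec e).add (v.2.choose_spec e))
      map_smul' := fun c u => PiLp.ext fun e => HasWeakDeriv.unique ((c • u).2.choose_spec e)
        ((u.2.choose_spec e).smul c) }

/-- `∏ₑ W^{2,2}(0, ρ(e))`. -/
def W22Edges : Submodule ℂ G.L2 where
  carrier := {u | ∃ hu : u ∈ G.D.domain, G.D ⟨u, hu⟩ ∈ G.D.domain}
  add_mem' := by
    rintro u v ⟨hu, hu'⟩ ⟨hv, hv'⟩
    refine ⟨G.D.domain.add_mem hu hv, ?_⟩
    have h : G.D ⟨u + v, G.D.domain.add_mem hu hv⟩ = G.D ⟨u, hu⟩ + G.D ⟨v, hv⟩ :=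
      G.D.map_add ⟨u, hu⟩ ⟨v, hv⟩
    rw [h]
    exact G.D.domain.add_mem hu' hv'
  zero_mem' := by
    refine ⟨G.D.domain.zero_mem, ?_⟩
    have h : G.D ⟨0, G.D.domain.zero_mem⟩ = 0 := G.D.map_zero
    rw [h]
    exact G.D.domain.zero_mem
  smul_mem' := by
    rintro c u ⟨hu, hu'⟩
    refine ⟨G.D.domain.smul_mem c hu, ?_⟩
    have h : G.D ⟨c • u, G.D.domain.smul_mem c hu⟩ = c • G.D ⟨u, hu⟩ := G.D.map_smul c ⟨u, hu⟩
    rw [h]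
    exact G.D.domain.smul_mem c hu'

theorem W22Edges_le : G.W22Edges ≤ G.D.domain := fun _ hu => hu.1

/-- `-d²/dx²` on every edge, with domain `∏ₑ W^{2,2}(0, ρ(e))`. -/
def negSecondDeriv : G.L2 →ₗ.[ℂ] G.L2 where
  domain := G.W22Edges
  toFun := - G.D.toFun ∘ₗ
    (G.D.toFun ∘ₗ Submodule.inclusion G.W22Edges_le).codRestrict G.D.domain (fun u => u.2.2)

theorem negSecondDeriv_apply (u : G.W22Edges) :
    G.negSecondDeriv u = - G.D ⟨G.D ⟨u, u.2.1⟩, u.2.2⟩ :=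
  rfl

/-- The continuity condition (Cc): there are node values `d` such that every `uₑ` has the boundary
values `uₑ(0) = d(v)` and `uₑ(ρ(e)) = d(w)` for `e = (v, w)`. -/
def continuityCondition : Submodule ℂ G.L2 where
  carrier := {u | ∃ d : V → ℂ, ∀ e, HasBoundaryValues (u e) (d e.1.1) (d e.1.2)}
  add_mem' := by
    rintro u v ⟨d, hd⟩ ⟨k, hk⟩
    exact ⟨d + k, fun e => (hd e).add (hk e)⟩
  zero_mem' := ⟨0, fun e => hasBoundaryValues_zero⟩
  smul_mem' := by
    rintro c u ⟨d, hd⟩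
    exact ⟨c • d, fun e => (hd e).smul c⟩

/-- The functions `u` with edgewise derivative `u' ∈ L²(𝔊)` such that `uₑ'(0) = uₑ'(ρ(e)) = 0` for
every edge `e`. -/
def neumannCondition : Submodule ℂ G.L2 where
  carrier := {u | ∃ hu : u ∈ G.D.domain, ∀ e, HasBoundaryValues (G.D ⟨u, hu⟩ e) 0 0}
  add_mem' := by
    rintro u v ⟨hu, hu'⟩ ⟨hv, hv'⟩
    refine ⟨G.D.domain.add_mem hu hv, fun e => ?_⟩
    have h : G.D ⟨u + v, G.D.domain.add_mem hu hv⟩ = G.D ⟨u, hu⟩ + G.D ⟨v, hv⟩ :=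
      G.D.map_add ⟨u, hu⟩ ⟨v, hv⟩
    rw [h]
    simpa using (hu' e).add (hv' e)
  zero_mem' := by
    refine ⟨G.D.domain.zero_mem, fun e => ?_⟩
    have h : G.D ⟨0, G.D.domain.zero_mem⟩ = 0 := G.D.map_zero
    rw [h]
    exact hasBoundaryValues_zero
  smul_mem' := by
    rintro c u ⟨hu, hu'⟩
    refine ⟨G.D.domain.smul_mem c hu, fun e => ?_⟩
    have h : G.D ⟨c • u, G.D.domain.smul_mem c hu⟩ = c • G.D ⟨u, hu⟩ := G.D.map_smul c ⟨u, hu⟩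
    rw [h]
    simpa using (hu' e).smul c

/-- The Kirchhoff condition (Kc): `∑ₑ ι⁺ᵥₑ uₑ'(ρ(e)) - ∑ₑ ι⁻ᵥₑ uₑ'(0) = 0` at every node `v`; here
`p e = uₑ'(0)` and `q e = uₑ'(ρ(e))`. -/
def kirchhoffCondition : Submodule ℂ G.L2 where
  carrier := {u | ∃ hu : u ∈ G.D.domain, ∃ p q : G.edges → ℂ,
    (∀ e, HasBoundaryValues (G.D ⟨u, hu⟩ e) (p e) (q e)) ∧
    ∀ v : V, ∑ e, G.incPlus v e * q e - ∑ e, G.incMinus v e * p e = 0}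
  add_mem' := by
    rintro u v ⟨hu, p, q, hu', hs⟩ ⟨hv, p', q', hv', hs'⟩
    refine ⟨G.D.domain.add_mem hu hv, p + p', q + q', fun e => ?_, fun x => ?_⟩
    · have h : G.D ⟨u + v, G.D.domain.add_mem hu hv⟩ = G.D ⟨u, hu⟩ + G.D ⟨v, hv⟩ :=
        G.D.map_add ⟨u, hu⟩ ⟨v, hv⟩
      rw [h]
      exact (hu' e).add (hv' e)
    · simp only [Pi.add_apply, mul_add, Finset.sum_add_distrib]
      linear_combination hs x + hs' x
  zero_mem' := by
    refine ⟨G.D.domain.zero_mem, 0, 0, fun e => ?_, fun x => by simp⟩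
    have h : G.D ⟨0, G.D.domain.zero_mem⟩ = 0 := G.D.map_zero
    rw [h]
    exact hasBoundaryValues_zero
  smul_mem' := by
    rintro c u ⟨hu, p, q, hu', hs⟩
    refine ⟨G.D.domain.smul_mem c hu, c • p, c • q, fun e => ?_, fun x => ?_⟩
    · have h : G.D ⟨c • u, G.D.domain.smul_mem c hu⟩ = c • G.D ⟨u, hu⟩ := G.D.map_smul c ⟨u, hu⟩
      rw [h]
      exact (hu' e).smul c
    · simp only [Pi.smul_apply, smul_eq_mul, mul_left_comm _ c, ← Finset.mul_sum]
      linear_combination c * hs x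

/-- `-Δ_cont`: minus the edgewise second derivative on the functions in `∏ₑ W^{2,2}(0, ρ(e))` that
satisfy (Cc) and `uₑ'(0) = uₑ'(ρ(e)) = 0` for every edge `e`. -/
def negLaplacianCont : G.L2 →ₗ.[ℂ] G.L2 :=
  G.negSecondDeriv.domRestrict (G.continuityCondition ⊓ G.neumannCondition)

/-- Minus the edgewise second derivative on the functions in `∏ₑ W^{2,2}(0, ρ(e))` that satisfy (Cc)
and (Kc). -/
def negLaplacianKirchhoff : G.L2 →ₗ.[ℂ] G.L2 :=
  G.negSecondDeriv.domRestrict (G.continuityCondition ⊓ G.kirchhoffCondition)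

/-- `W^{1,2}(𝔊)`: the functions in `∏ₑ W^{1,2}(0, ρ(e))` that satisfy (Cc). -/
def W12 : Submodule ℂ G.L2 := G.D.domain ⊓ G.continuityCondition

/-- `(u, v) ↦ ∑ₑ ∫₀^{ρ(e)} uₑ' conj(vₑ')` on `W^{1,2}(𝔊)`, written as the inner product of the
derivatives in `L²(𝔊)`. -/
def dirichletForm : SesqForm G.L2 where
  domain := G.W12
  toFun := LinearMap.mk₂'ₛₗ (RingHom.id ℂ) (starRingEnd ℂ)
    (fun u v => inner ℂ (G.D ⟨v, v.2.1⟩) (G.D ⟨u, u.2.1⟩))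
    (fun u u' v => by
      rw [← inner_add_right, ← G.D.map_add]
      rfl)
    (fun c u v => by
      rw [RingHom.id_apply, smul_eq_mul, ← inner_smul_right, ← G.D.map_smul]
      rfl)
    (fun u v v' => by
      rw [← inner_add_left, ← G.D.map_add]
      rfl)
    (fun c u v => by
      rw [smul_eq_mul, ← inner_smul_left, ← G.D.map_smul]
      rfl)

/-- The form is the announced sum of integrals. -/
theorem dirichletForm_apply (u v : G.W12) :
    G.dirichletForm.toFun u v = ∑ e, ∫ x in Ioo 0 (G.length e),
      (G.D ⟨u, u.2.1⟩ e : IntervalL2 (G.length e)) x *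
        starRingEnd ℂ ((G.D ⟨v, v.2.1⟩ e : IntervalL2 (G.length e)) x) :=
  rfl

end MetricGraph

end

/-! Green's formula on the edges writes the difference between `(-u'' | w)` and the inner product of
`u'` with `w'` as a sum of endpoint terms. If `w` satisfies (Cc), these terms group node by node
into the conjugate of `w`'s node value times the Kirchhoff sum of `u` (`sum_mul_incidence`). So (Kc)
is exactly the natural boundary condition of the Dirichlet form.

The central point is `mem_graph_of_weak`: a weak solution in `W^{1,2}(𝔊)` tested only against Dom(A)
already lies in Dom(A_F). Bumps inside a single edge give the differential equation, and functions
with prescribed node values and flat ends give (Kc); both kinds belong to Dom(A). Hence `a_F` is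
associated with A_F. Moreover, if `v` is orthogonal to Dom(A) for the form norm, then A_F v = -v, so
‖v'‖² = -‖v‖² and v = 0. Thus Dom(A) is a form core. The derivative on `W^{1,2}(𝔊)` is a closed
operator, because node values depend continuously on `(u, u')` (`isClosed_gradient`). Hence `a_F` is
closed, and it is the closure of the form of A.

Closedness also allows projecting `(f, 0)` onto the graph of the derivative, which solves (1 + A_F)u
= f weakly and hence strongly; a symmetric, densely defined operator with 1 + A_F onto is
self-adjoint.

Maximality is abstract (`formLE_of_isClosureOf`). A positive self-adjoint extension C of A has a
closed form `c`, built from the square root of (1 + C)⁻¹. On Dom(A) it coincides with the form of A,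
and closedness of `c` carries the comparison over to the closure. -/

noncomputable section

/-! ### Closed forms and positive self-adjoint operators on a Hilbert space. -/

section Abstract

variable {H : Type*} [NormedAddCommGroup H] [InnerProductSpace ℂ H]

namespace SesqForm

/-- A positive form is a possibly degenerate inner product, so this is Minkowski's inequality for
its seminorm. The arguments are swapped because Mathlib's inner product is conjugate-linear in the
first slot. -/
theorem IsPositive.sqrt_add_le {a : SesqForm H} (ha : a.IsPositive) (u v : a.domain) :
    √(a.toFun (u + v) (u + v)).re ≤ √(a.toFun u u).re + √(a.toFun v v).re := by
  let c : PreInnerProductSpace.Core ℂ a.domain :=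
    { inner := fun x y => a.toFun y x
      conj_inner_symm := fun x y => (ha.1 y x).symm
      re_inner_nonneg := fun x => ha.2 x
      add_left := fun x y z => (a.toFun z).map_add x y
      smul_left := fun x y r => (a.toFun y).map_smulₛₗ r x }
  let := c
  let := InnerProductSpace.Core.toSeminormedAddCommGroup (𝕜 := ℂ) (F := a.domain)
  exact norm_add_le u v

theorem IsPositive.sqrt_sub_le {a : SesqForm H} (ha : a.IsPositive) (u v : a.domain) :
    √(a.toFun (u - v) (u - v)).re ≤ √(a.toFun u u).re + √(a.toFun v v).re := by
  have := ha.sqrt_add_le u (-v)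
  simpa [sub_eq_add_neg] using this

end SesqForm

namespace LinearPMap

/-- A symmetric, densely defined operator `B` with `1 + B` surjective is self-adjoint. -/
theorem isSelfAdjoint_of_surjective [CompleteSpace H] {B : H →ₗ.[ℂ] H}
    (hd : Dense (B.domain : Set H))
    (hs : ∀ u v : B.domain, inner ℂ (B u) (v : H) = inner ℂ (u : H) (B v))
    (hr : ∀ f : H, ∃ u : B.domain, (u : H) + B u = f) : IsSelfAdjoint B := by
  rw [isSelfAdjoint_def]
  have hle : B ≤ B.adjoint := IsFormalAdjoint.le_adjoint hd hs
  refine le_antisymm ?_ hle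
  have key : ∀ v : B.adjoint.domain, ∃ u : B.domain, (u : H) = v ∧ B u = B.adjoint v := by
    intro v
    obtain ⟨u, hu⟩ := hr (v + B.adjoint v)
    have huv : (u : H) = v := by
      -- Since `u - v` is annihilated by the adjoint of `1 + B`, it is orthogonal to the range of `1
      -- + B`; surjectivity puts `u - v` itself in that range.
      obtain ⟨w, hw⟩ := hr ((u : H) - v)
      have h1 := adjoint_isFormalAdjoint hd v w
      have h2 := hs u w
      have h3 : inner ℂ ((u : H) - v) ((w : H) + B w) = 0 := by
        have h4 : inner ℂ ((u : H) + B u) (w : H) = inner ℂ ((v : H) + B.adjoint v) (w : H) := by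
          rw [hu]
        rw [inner_add_left, inner_add_left, h1, h2] at h4
        rw [inner_sub_left, inner_add_right, inner_add_right]
        linear_combination h4
      rw [hw] at h3
      exact sub_eq_zero.1 (inner_self_eq_zero.1 h3)
    refine ⟨u, huv, ?_⟩
    rw [huv] at hu
    exact add_left_cancel hu
  refine ⟨fun v hv => ?_, ?_⟩
  · obtain ⟨u, hu, -⟩ := key ⟨v, hv⟩
    have : v = u := hu.symm
    rw [this]
    exact u.2
  · intro x y hxy
    obtain ⟨u, hu, hu'⟩ := key x
    rw [← hu']
    congr 1
    exact Subtype.ext (hu.trans hxy)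

/-- For a self-adjoint positive semidefinite operator `C`, the bounded inverse of `1 + C`. -/
theorem exists_resolvent [CompleteSpace H] {C : H →ₗ.[ℂ] H} (hC : IsSelfAdjoint C)
    (hp : C.IsPosSemidef) : ∃ R : H →L[ℂ] H, 0 ≤ R ∧ (∀ f, ‖R f‖ ≤ ‖f‖) ∧
      ∀ u f, R f = u ↔ (u, f - u) ∈ C.graph := by
  have hd := hC.dense_domain
  -- Positivity bounds `1 + C` below by the identity. This gives the closed range, the injectivity
  -- and the contractivity of the inverse.
  have hlow : ∀ u : C.domain, ‖(u : H)‖ ≤ ‖(u : H) + C u‖ := by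
    intro u
    have h1 : ‖(u : H)‖ ^ 2 ≤ ‖(u : H)‖ * ‖(u : H) + C u‖ := by
      have h2 := hp.2 u
      have h3 : (inner ℂ ((u : H) + C u) (u : H)).re = ‖(u : H)‖ ^ 2 + (inner ℂ (C u) (u : H)).re := by
        rw [inner_add_left, Complex.add_re, inner_self_eq_norm_sq_to_K]
        norm_cast
      have h4 := (Complex.re_le_norm _).trans (norm_inner_le_norm (𝕜 := ℂ) ((u : H) + C u) (u : H))
      nlinarith
    by_cases h0 : ‖(u : H)‖ = 0
    · rw [h0]; positivity
    · have : 0 < ‖(u : H)‖ := lt_of_le_of_ne (norm_nonneg _) (Ne.symm h0)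
      nlinarith
  let T : C.domain →ₗ[ℂ] H := C.domain.subtype + C.toFun
  have hT : ∀ u, T u = (u : H) + C u := fun u => rfl
  have hclosed : _root_.IsClosed (LinearMap.range T : Set H) := by
    apply isClosed_of_closure_subset
    intro f hf
    obtain ⟨y, hy, hyf⟩ := mem_closure_iff_seq_limit.1 hf
    choose x hx using hy
    have hcx : CauchySeq fun n => (x n : H) := by
      rw [Metric.cauchySeq_iff']
      intro ε hε
      obtain ⟨N, hN⟩ := (Metric.cauchySeq_iff'.1 hyf.cauchySeq) ε hε
      refine ⟨N, fun n hn => ?_⟩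
      refine lt_of_le_of_lt ?_ (hN n hn)
      rw [dist_eq_norm, dist_eq_norm, ← hx, ← hx, ← _root_.map_sub]
      exact hlow (x n - x N)
    obtain ⟨u, hu⟩ := cauchySeq_tendsto_of_complete hcx
    have hCx : Tendsto (fun n => C (x n)) atTop (𝓝 (f - u)) := by
      refine (hyf.sub hu).congr fun n => ?_
      rw [← hx, hT, add_sub_cancel_left]
    have hgr : (u, f - u) ∈ C.graph := by
      refine hC.isClosed.mem_of_tendsto (hu.prodMk_nhds hCx) (Eventually.of_forall fun n => ?_)
      exact C.mem_graph (x n)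
    obtain ⟨v, hv, hv'⟩ := C.mem_graph_iff.1 hgr
    exact ⟨v, by rw [hT, hv, hv']; simp⟩
  -- A vector `v` orthogonal to the range satisfies `C† v = -v`, hence `C v = -v`, and the lower
  -- bound forces `v = 0`.
  have hsurj : LinearMap.range T = ⊤ := by
    have : CompleteSpace (LinearMap.range T) := hclosed.completeSpace_coe
    rw [← Submodule.orthogonal_eq_bot_iff, Submodule.eq_bot_iff]
    intro v hv
    rw [Submodule.mem_orthogonal] at hv
    have hv1 : ∀ u : C.domain, inner ℂ (-v) (u : H) = inner ℂ v (C u) := by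
      intro u
      have := hv _ (LinearMap.mem_range_self T u)
      rw [← inner_conj_symm, map_eq_zero, hT, inner_add_right] at this
      rw [inner_neg_left]
      linear_combination -this
    have hvd : v ∈ C.adjoint.domain := mem_adjoint_domain_of_exists v ⟨_, hv1⟩
    have hvg : (v, -v) ∈ C.graph := by
      have h1 : C.adjoint ⟨v, hvd⟩ = -v := adjoint_apply_eq hd _ hv1
      have h2 : (v, -v) ∈ C.adjoint.graph := by
        rw [← h1]
        exact C.adjoint.mem_graph ⟨v, hvd⟩
      rwa [isSelfAdjoint_def.1 hC] at h2
    obtain ⟨w, hw, hw'⟩ := C.mem_graph_iff.1 hvg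
    have := hlow w
    simp only at hw hw'
    rw [hw', hw, add_neg_cancel, norm_zero] at this
    exact norm_le_zero_iff.1 this
  have hinj : Function.Injective T := by
    rw [injective_iff_map_eq_zero]
    intro u hu
    have := hlow u
    rw [← hT, hu, norm_zero] at this
    exact Subtype.ext (norm_le_zero_iff.1 this)
  let E : C.domain ≃ₗ[ℂ] H := LinearEquiv.ofBijective T ⟨hinj, LinearMap.range_eq_top.1 hsurj⟩
  have hE : ∀ f, (E.symm f : H) + C (E.symm f) = f := fun f => E.apply_symm_apply f
  have hb : ∀ f, ‖(E.symm f : H)‖ ≤ ‖f‖ := fun f => by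
    have := hlow (E.symm f)
    rwa [hE] at this
  let R : H →L[ℂ] H := (C.domain.subtype ∘ₗ E.symm.toLinearMap).mkContinuous 1
    (fun f => by rw [one_mul]; exact hb f)
  have hR : ∀ f, R f = E.symm f := fun f => rfl
  refine ⟨R, ?_, hb, ?_⟩
  · rw [ContinuousLinearMap.nonneg_iff_isPositive, ContinuousLinearMap.isPositive_def']
    constructor
    · rw [ContinuousLinearMap.isSelfAdjoint_iff_isSymmetric]
      intro f g
      change inner ℂ (R f) g = inner ℂ f (R g)
      have h1 := hp.1 (E.symm f) (E.symm g)
      nth_rw 1 [← hE g]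
      nth_rw 2 [← hE f]
      rw [hR, hR, inner_add_left, inner_add_right, h1]
    · intro f
      rw [ContinuousLinearMap.reApplyInnerSelf_apply]
      have h1 := hp.2 (E.symm f)
      nth_rw 2 [← hE f]
      rw [hR, inner_add_right, _root_.map_add, inner_self_eq_norm_sq]
      rw [← inner_conj_symm, Complex.conj_re] at h1
      exact add_nonneg (by positivity) h1
  · intro u f
    rw [mem_graph_iff]
    constructor
    · rintro rfl
      refine ⟨E.symm f, rfl, ?_⟩
      exact eq_sub_of_add_eq' (hE f)
    · rintro ⟨w, hw, hw'⟩
      simp only at hw hw'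
      have h2 : E w = f := by
        change (w : H) + C w = f
        rw [hw', hw]; simp
      rw [hR, ← h2, E.symm_apply_apply, hw]


/-- A self-adjoint positive semidefinite operator is associated with a densely defined closed
positive form. -/
theorem exists_closed_form [CompleteSpace H] {C : H →ₗ.[ℂ] H} (hC : IsSelfAdjoint C)
    (hp : C.IsPosSemidef) : ∃ c : SesqForm H, c.IsPositive ∧ c.IsClosed ∧
      Dense (c.domain : Set H) ∧ c.IsAssociated C := by
  obtain ⟨R, hR0, hRb, hR⟩ := exists_resolvent hC hp
  -- `S` plays the role of (1 + C)^(-1/2). Its range is the form domain, its inverse `J` is (1 +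
  -- C)^(1/2), and the form is `(J u | J v) - (u | v)`.
  obtain ⟨S, hS0, hSS⟩ : ∃ S : H →L[ℂ] H, 0 ≤ S ∧ S * S = R :=
    ⟨CFC.sqrt R, CFC.sqrt_nonneg R, CFC.sqrt_mul_sqrt_self R hR0⟩
  have hSR : ∀ x, S (S x) = R x := fun x => by rw [← hSS]; rfl
  have hsym : ∀ x y, inner ℂ (S x) y = inner ℂ x (S y) :=
    ((ContinuousLinearMap.nonneg_iff_isPositive S).1 hS0).inner_left_eq_inner_right
  have hinj : Function.Injective S := by
    rw [injective_iff_map_eq_zero]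
    intro y hy
    have h1 : R y = 0 := by rw [← hSR, hy, _root_.map_zero]
    obtain ⟨w, hw, hw'⟩ := C.mem_graph_iff.1 ((hR 0 y).1 h1)
    simp only [sub_zero] at hw hw'
    have : w = 0 := Subtype.ext hw
    rw [← hw', this, map_zero]
  have hSb : ∀ y, ‖S y‖ ≤ ‖y‖ := by
    intro y
    have h1 : ‖S y‖ ^ 2 ≤ ‖y‖ ^ 2 := by
      have h2 : ‖S y‖ ^ 2 = (inner ℂ y (R y)).re := by
        rw [← hSR, ← hsym, inner_self_eq_norm_sq_to_K]
        norm_cast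
      rw [h2]
      calc _ ≤ ‖y‖ * ‖R y‖ := (Complex.re_le_norm _).trans (norm_inner_le_norm _ _)
        _ ≤ ‖y‖ * ‖y‖ := by gcongr; exact hRb y
        _ = ‖y‖ ^ 2 := by ring
    exact le_of_sq_le_sq h1 (norm_nonneg _)
  let D : Submodule ℂ H := LinearMap.range (S : H →ₗ[ℂ] H)
  let J : D ≃ₗ[ℂ] H := (LinearEquiv.ofInjective (S : H →ₗ[ℂ] H) hinj).symm
  have hJ : ∀ u : D, S (J u) = u := fun u =>
    congrArg Subtype.val ((LinearEquiv.ofInjective (S : H →ₗ[ℂ] H) hinj).apply_symm_apply u)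
  have hJ' : ∀ (y : H) (h : S y ∈ D), J ⟨S y, h⟩ = y := fun y h => hinj (hJ _)
  let c : SesqForm H :=
    { domain := D
      toFun := LinearMap.mk₂'ₛₗ (RingHom.id ℂ) (starRingEnd ℂ)
        (fun u v => inner ℂ (J v) (J u) - inner ℂ (v : H) (u : H))
        (fun u u' v => by
          rw [_root_.map_add, inner_add_right, Submodule.coe_add, inner_add_right]; ring)
        (fun k u v => by
          rw [_root_.map_smul, inner_smul_right, Submodule.coe_smul, inner_smul_right, RingHom.id_apply,
            smul_eq_mul]
          ring)
        (fun u v v' => by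
          rw [_root_.map_add, inner_add_left, Submodule.coe_add, inner_add_left]; ring)
        (fun k u v => by
          rw [_root_.map_smul, inner_smul_left, Submodule.coe_smul, inner_smul_left, smul_eq_mul]
          ring) }
  have hc : ∀ u v : D, c.toFun u v = inner ℂ (J v) (J u) - inner ℂ (v : H) (u : H) :=
    fun _ _ => rfl
  have hcs : ∀ u : D, c.toFun u u = ((‖J u‖ ^ 2 - ‖(u : H)‖ ^ 2 : ℝ) : ℂ) := fun u => by
    rw [hc, inner_self_eq_norm_sq_to_K, inner_self_eq_norm_sq_to_K]
    norm_cast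
  refine ⟨c, ⟨fun u v => ?_, fun u => ?_⟩, ?_, ?_, ?_⟩
  · rw [hc, hc, _root_.map_sub, inner_conj_symm, inner_conj_symm]
  · rw [hcs, Complex.ofReal_re, sub_nonneg]
    have := hSb (J u)
    rw [hJ] at this
    gcongr
  · intro x u hu hx
    have hcau : CauchySeq fun n => J (x n) := by
      rw [Metric.cauchySeq_iff]
      intro ε hε
      obtain ⟨N, hN⟩ := hx (ε ^ 2 / 2) (by positivity)
      obtain ⟨M, hM⟩ := (Metric.cauchySeq_iff.1 hu.cauchySeq) (ε / 2) (by positivity)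
      refine ⟨max N M, fun m hm n hn => ?_⟩
      have h1 := hN m (le_of_max_le_left hm) n (le_of_max_le_left hn)
      have h2 := hM m (le_of_max_le_right hm) n (le_of_max_le_right hn)
      rw [hcs, Complex.ofReal_re, _root_.map_sub, Submodule.coe_sub] at h1
      rw [dist_eq_norm] at h2 ⊢
      refine lt_of_pow_lt_pow_left₀ 2 hε.le ?_
      -- ‖J x‖² is the form plus ‖x‖², so the squared distance is below ε²/2 + ε²/4.
      nlinarith [norm_nonneg ((x m : H) - (x n : H))]
    obtain ⟨y, hy⟩ := cauchySeq_tendsto_of_complete hcau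
    have hSy : S y = u := by
      refine tendsto_nhds_unique ((S.continuous.tendsto y).comp hy) (hu.congr fun n => ?_)
      exact (hJ (x n)).symm
    have hmem : u ∈ D := ⟨y, hSy⟩
    have hJu : J ⟨u, hmem⟩ = y := hinj (by rw [hJ, hSy])
    refine ⟨hmem, ?_⟩
    have h1 : Tendsto (fun n => ‖J (x n) - y‖ ^ 2 - ‖(x n : H) - u‖ ^ 2) atTop (𝓝 0) := by
      have ha := (tendsto_iff_norm_sub_tendsto_zero.1 hy).pow 2
      have hb := (tendsto_iff_norm_sub_tendsto_zero.1 hu).pow 2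
      simpa using ha.sub hb
    have h2 := (Complex.continuous_ofReal.tendsto 0).comp h1
    rw [Complex.ofReal_zero] at h2
    refine h2.congr fun n => ?_
    have h3 := hcs (x n - ⟨u, hmem⟩)
    have h4 : J (x n - ⟨u, hmem⟩) = J (x n) - y := by
      rw [← hJu]
      exact J.map_sub _ _
    rw [h4] at h3
    exact h3.symm
  -- Dom(C) is contained in the range of `R = S²`, hence in the range of `S`.
  · refine hC.dense_domain.mono fun u hu => ?_
    have h1 := (hR u (u + C ⟨u, hu⟩)).2 (by
      rw [add_sub_cancel_left]; exact C.mem_graph ⟨u, hu⟩)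
    exact ⟨S (u + C ⟨u, hu⟩), (hSR _).trans h1⟩
  · intro u g
    have h0 : (u, g) ∈ C.graph ↔ R (g + u) = u := by rw [hR, add_sub_cancel_right]
    rw [h0]
    constructor
    · intro h
      have hSu : S (S (g + u)) = u := by rw [hSR, h]
      have hu : u ∈ D := ⟨S (g + u), hSu⟩
      have hJu : J ⟨u, hu⟩ = S (g + u) := hinj (by rw [hJ, hSu])
      refine ⟨hu, fun w => ?_⟩
      change _ = inner ℂ (J w) (J ⟨u, hu⟩) - inner ℂ (w : H) u
      rw [hJu, ← hsym, hJ, inner_add_right, add_sub_cancel_right]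
    · rintro ⟨hu, h⟩
      -- Every `z` in `H` equals `J (S z)`, so testing with `w = S z` determines `J u` completely.
      have key : J ⟨u, hu⟩ = S (g + u) := by
        refine ext_inner_left ℂ fun z => ?_
        have h1 := h ⟨S z, ⟨z, rfl⟩⟩
        have h2 : J ⟨S z, ⟨z, rfl⟩⟩ = z := hJ' _ _
        change inner ℂ (S z) g = inner ℂ (J ⟨S z, ⟨z, rfl⟩⟩) (J ⟨u, hu⟩) - inner ℂ (S z) u at h1
        rw [h2] at h1
        rw [← hsym, inner_add_right]
        linear_combination -h1
      rw [← hSR, ← key, hJ]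

/-- If a closed form `b` with associated operator `B` is the closure of the form of `A`, then every
self-adjoint positive semidefinite extension of `A` is smaller than `B`. -/
theorem formLE_of_isClosureOf [CompleteSpace H] {A B C : H →ₗ.[ℂ] H} {b : SesqForm H}
    (hb : b.IsClosureOf A.toForm) (hbd : Dense (b.domain : Set H)) (hbB : b.IsAssociated B)
    (hAC : A ≤ C) (hC : IsSelfAdjoint C) (hp : C.IsPosSemidef) : FormLE C B := by
  obtain ⟨hbp, hbc, hAb', hbA', hcore'⟩ := hb
  have hAb : A.domain ≤ b.domain := hAb'
  have hbA : ∀ u v : A.domain, b.toFun (Submodule.inclusion hAb u) (Submodule.inclusion hAb v) =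
    inner ℂ (v : H) (A u) := hbA'
  have hcore : ∀ u : b.domain, ∃ x : ℕ → A.domain, Tendsto (fun n => (x n : H)) atTop (𝓝 (u : H)) ∧
    Tendsto (fun n => b.toFun (Submodule.inclusion hAb (x n) - u)
      (Submodule.inclusion hAb (x n) - u)) atTop (𝓝 0) := hcore'
  obtain ⟨c, hcp, hcc, hcd, hcC⟩ := exists_closed_form hC hp
  have hA : ∀ u : A.domain, ∃ hu : (u : H) ∈ c.domain,
      ∀ w : c.domain, inner ℂ (w : H) (A u) = c.toFun ⟨u, hu⟩ w := fun u =>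
    (hcC u (A u)).1 (le_graph_of_le hAC (A.mem_graph u))
  have hAle : A.domain ≤ c.domain := fun u hu => (hA ⟨u, hu⟩).1
  have hcA : ∀ u v : A.domain,
      c.toFun (Submodule.inclusion hAle u) (Submodule.inclusion hAle v) =
        b.toFun (Submodule.inclusion hAb u) (Submodule.inclusion hAb v) := fun u v => by
    rw [hbA]
    exact ((hA u).2 (Submodule.inclusion hAle v)).symm
  have key : ∀ u : b.domain, ∃ hu : (u : H) ∈ c.domain,
      (c.toFun ⟨u, hu⟩ ⟨u, hu⟩).re ≤ (b.toFun u u).re := by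
    intro u
    obtain ⟨x, hxu, hxb⟩ := hcore u
    have hbre : ∀ p : b.domain, 0 ≤ (b.toFun p p).re := hbp.2
    have hsqrt := SesqForm.IsPositive.sqrt_sub_le hbp
    have hsc := SesqForm.IsPositive.sqrt_sub_le hcp
    have hlim : Tendsto (fun n => √(b.toFun (Submodule.inclusion hAb (x n) - u)
        (Submodule.inclusion hAb (x n) - u)).re) atTop (𝓝 0) := by
      have h1 := ((Real.continuous_sqrt.comp Complex.continuous_re).tendsto 0).comp hxb
      rwa [Function.comp_apply, Complex.zero_re, Real.sqrt_zero] at h1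
    -- The approximating sequence is Cauchy for `b`, hence for `c`, since the two forms agree on
    -- Dom(A).
    obtain ⟨hu, hcu⟩ := hcc (fun n => Submodule.inclusion hAle (x n)) u hxu (by
      intro ε hε
      have hε' : 0 < √ε / 2 := by positivity
      obtain ⟨N, hN⟩ := eventually_atTop.1 (hlim.eventually_lt_const hε')
      refine ⟨N, fun m hm n hn => ?_⟩
      rw [← _root_.map_sub, hcA, _root_.map_sub]
      have h1 := hsqrt (Submodule.inclusion hAb (x m) - u) (Submodule.inclusion hAb (x n) - u)
      rw [sub_sub_sub_cancel_right] at h1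
      have h2 := hN m hm
      have h3 := hN n hn
      exact (Real.sqrt_lt_sqrt_iff (hbre _)).1 (by linarith))
    refine ⟨hu, ?_⟩
    have hlimc : Tendsto (fun n => √(c.toFun (Submodule.inclusion hAle (x n) - ⟨u, hu⟩)
        (Submodule.inclusion hAle (x n) - ⟨u, hu⟩)).re) atTop (𝓝 0) := by
      have h1 := ((Real.continuous_sqrt.comp Complex.continuous_re).tendsto 0).comp hcu
      rwa [Function.comp_apply, Complex.zero_re, Real.sqrt_zero] at h1
    have hle : ∀ n, √(c.toFun ⟨u, hu⟩ ⟨u, hu⟩).re ≤ √(b.toFun u u).re +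
        (√(b.toFun (Submodule.inclusion hAb (x n) - u) (Submodule.inclusion hAb (x n) - u)).re +
        √(c.toFun (Submodule.inclusion hAle (x n) - ⟨u, hu⟩)
        (Submodule.inclusion hAle (x n) - ⟨u, hu⟩)).re) := by
      -- Pass from `u` to `x n` in the seminorm of `c`, replace `c` by `b` at `x n`, and return to
      -- `u` in the seminorm of `b`.
      intro n
      have h1 := hsc (Submodule.inclusion hAle (x n))
        (Submodule.inclusion hAle (x n) - ⟨u, hu⟩)
      have h2 := SesqForm.IsPositive.sqrt_add_le hbp u (Submodule.inclusion hAb (x n) - u)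
      rw [sub_sub_cancel, hcA] at h1
      rw [add_sub_cancel] at h2
      linarith
    have := ge_of_tendsto' ((hlim.add hlimc).const_add (√(b.toFun u u).re)) hle
    rw [add_zero, add_zero] at this
    exact (Real.sqrt_le_sqrt_iff (hbre u)).1 this
  refine ⟨c, b, ⟨hcp, hcc, hcd, hcC⟩, ⟨hbp, hbc, hbd, hbB⟩, fun u hu => (key ⟨u, hu⟩).1, ?_⟩
  exact fun u => (key u).2

/-- The product `H × H` carries the sup norm; moving the graph to `WithLp 2 (H × H)` makes
orthogonal projections onto it available. -/
theorem IsClosed.map_graph {T : H →ₗ.[ℂ] H} (hT : T.IsClosed) :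
    _root_.IsClosed ((T.graph.map (WithLp.linearEquiv 2 ℂ (H × H)).symm.toLinearMap :
      Submodule ℂ (WithLp 2 (H × H))) : Set (WithLp 2 (H × H))) := by
  convert! _root_.IsClosed.preimage (WithLp.prod_continuous_ofLp 2 H H) hT using 1
  ext x
  exact Submodule.mem_map_equiv _

/-- Weak solvability of `(1 + T† T) u = f` for a closed operator `T`. -/
theorem IsClosed.exists_weak_solution [CompleteSpace H] {T : H →ₗ.[ℂ] H} (hT : T.IsClosed)
    (f : H) : ∃ u : T.domain, ∀ w : T.domain,
      inner ℂ (w : H) f = inner ℂ (w : H) (u : H) + inner ℂ (T w) (T u) := by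
  let E := (WithLp.linearEquiv 2 ℂ (H × H)).symm
  let K : Submodule ℂ (WithLp 2 (H × H)) := T.graph.map E.toLinearMap
  have hK : _root_.IsClosed (K : Set (WithLp 2 (H × H))) := hT.map_graph
  have : CompleteSpace K := hK.completeSpace_coe
  -- The projection of `(f, 0)` onto the graph is `(u, T u)`; orthogonality of the residual to every
  -- `(w, T w)` is the weak equation.
  have h1 := Submodule.starProjection_inner_eq_zero (K := K) (WithLp.toLp 2 (f, 0))
  obtain ⟨p, hp, hpe⟩ := Submodule.starProjection_apply_mem K (WithLp.toLp 2 (f, (0 : H)))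
  obtain ⟨u, hu, hu'⟩ := T.mem_graph_iff.1 hp
  refine ⟨u, fun w => ?_⟩
  have h2 := h1 (WithLp.toLp 2 ((w : H), T w)) ⟨_, T.mem_graph w, rfl⟩
  rw [← hpe] at h2
  rw [← inner_conj_symm, map_eq_zero] at h2
  rw [WithLp.prod_inner_apply] at h2
  change inner ℂ (w : H) (f - p.1) + inner ℂ (T w) (0 - p.2) = 0 at h2
  rw [← hu, ← hu', inner_sub_right, zero_sub, inner_neg_right] at h2
  linear_combination h2

/-- A subspace of the domain of a closed operator is a core if its orthogonal complement in the
graph is trivial. -/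
theorem IsClosed.exists_seq_of_orthogonal [CompleteSpace H] {T : H →ₗ.[ℂ] H} (hT : T.IsClosed)
    {S : Submodule ℂ H} (hS : S ≤ T.domain)
    (h : ∀ u : T.domain, (∀ w : S, inner ℂ (w : H) (u : H) +
      inner ℂ (T (Submodule.inclusion hS w)) (T u) = 0) → u = 0) (u : T.domain) :
    ∃ x : ℕ → S, Tendsto (fun n => (x n : H)) atTop (𝓝 (u : H)) ∧
      Tendsto (fun n => T (Submodule.inclusion hS (x n))) atTop (𝓝 (T u)) := by
  let E := (WithLp.linearEquiv 2 ℂ (H × H)).symm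
  let K : Submodule ℂ (WithLp 2 (H × H)) := T.graph.map E.toLinearMap
  let ι : S →ₗ[ℂ] WithLp 2 (H × H) := E.toLinearMap ∘ₗ
    (S.subtype.prod (T.toFun ∘ₗ Submodule.inclusion hS))
  let L : Submodule ℂ (WithLp 2 (H × H)) := (LinearMap.range ι).topologicalClosure
  have hK : _root_.IsClosed (K : Set (WithLp 2 (H × H))) := hT.map_graph
  have hLK : L ≤ K := by
    refine Submodule.topologicalClosure_minimal _ ?_ hK
    rintro _ ⟨w, rfl⟩
    exact ⟨_, T.mem_graph (Submodule.inclusion hS w), rfl⟩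
  have : CompleteSpace L := (Submodule.isClosed_topologicalClosure _).completeSpace_coe
  let k : WithLp 2 (H × H) := WithLp.toLp 2 ((u : H), T u)
  have hk : k ∈ K := ⟨_, T.mem_graph u, rfl⟩
  -- The residual of the projection of `(u, T u)` onto `L`, the closure of the graph over `S`, stays
  -- in the graph of `T` and is orthogonal to `L`, so `h` annihilates it.
  have hkL : k ∈ L := by
    have h1 := Submodule.starProjection_inner_eq_zero (K := L) k
    have hmem : k - L.starProjection k ∈ K :=
      K.sub_mem hk (hLK (Submodule.starProjection_apply_mem L k))
    obtain ⟨p, hp, hpe⟩ := hmem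
    obtain ⟨v, hv, hv'⟩ := T.mem_graph_iff.1 hp
    have hv0 : v = 0 := by
      refine h v fun w => ?_
      have h2 := h1 (ι w) (Submodule.le_topologicalClosure _ ⟨w, rfl⟩)
      rw [← inner_conj_symm, map_eq_zero, ← hpe, WithLp.prod_inner_apply] at h2
      change inner ℂ (w : H) p.1 + inner ℂ (T (Submodule.inclusion hS w)) p.2 = 0 at h2
      rwa [← hv, ← hv'] at h2
    have hp0 : p = 0 := by
      refine Prod.ext ?_ ?_
      · rw [← hv, hv0]; rfl
      · rw [← hv', hv0, map_zero]; rfl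
    rw [hp0, _root_.map_zero] at hpe
    rw [sub_eq_zero.1 hpe.symm]
    exact Submodule.starProjection_apply_mem L k
  obtain ⟨y, hy, hyk⟩ := mem_closure_iff_seq_limit.1 hkL
  choose x hx using hy
  have hlim := (((WithLp.prod_continuous_ofLp 2 H H).tendsto k).comp hyk)
  refine ⟨x, ?_, ?_⟩
  · refine ((continuous_fst.tendsto _).comp hlim).congr fun n => ?_
    simp only [Function.comp_apply, ← hx]
    rfl
  · refine ((continuous_snd.tendsto _).comp hlim).congr fun n => ?_
    simp only [Function.comp_apply, ← hx]
    rfl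

end LinearPMap

end Abstract

/-! ### Weak derivatives, primitives and boundary values on an interval. -/

section Interval

-- The increments are dominated by those of the primitive of `‖g‖`.
open AbsolutelyContinuousOnInterval in
theorem IntervalIntegrable.absolutelyContinuousOnInterval_integral {g : ℝ → ℂ} {a b : ℝ}
    (h : IntervalIntegrable g volume a b) :
    AbsolutelyContinuousOnInterval (fun x => ∫ t in a..x, g t) a b := by
  have hN := h.norm.absolutelyContinuousOnInterval_intervalIntegral (c := a) left_mem_uIcc
  refine squeeze_zero' (Eventually.of_forall fun E => Finset.sum_nonneg fun _ _ => dist_nonneg)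
    ?_ hN
  have hE : ∀ᶠ E in totalLengthFilter ⊓ 𝓟 (disjWithin a b), E ∈ disjWithin a b :=
    eventually_inf_principal.mpr (by simp)
  filter_upwards [hE] with E hE
  refine Finset.sum_le_sum fun i hi => ?_
  obtain ⟨h1, h2⟩ := hE.1 i hi
  have hi1 : IntervalIntegrable g volume a (E.2 i).1 :=
    h.mono_set (uIcc_subset_uIcc left_mem_uIcc h1)
  have hi2 : IntervalIntegrable g volume a (E.2 i).2 :=
    h.mono_set (uIcc_subset_uIcc left_mem_uIcc h2)
  rw [dist_eq_norm, dist_eq_norm, intervalIntegral.integral_interval_sub_left hi1 hi2,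
    intervalIntegral.integral_interval_sub_left hi1.norm hi2.norm, Real.norm_eq_abs]
  exact intervalIntegral.norm_integral_le_abs_integral_norm

theorem absolutelyContinuousOnInterval_const_add {F : ℝ → ℂ} {a b : ℝ} (c : ℂ)
    (h : AbsolutelyContinuousOnInterval F a b) :
    AbsolutelyContinuousOnInterval (fun x => c + F x) a b := by
  unfold AbsolutelyContinuousOnInterval at h ⊢
  simpa only [dist_add_left] using h

/-- Integration by parts for indefinite integrals. -/
theorem integral_primitive_mul_primitive {g h : ℝ → ℂ} {a b : ℝ} (hg : IntervalIntegrable g volume a b)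
    (hh : IntervalIntegrable h volume a b) (c d : ℂ) :
    ∫ x in a..b, (g x * (d + ∫ t in a..x, h t) + (c + ∫ t in a..x, g t) * h x) =
      (c + ∫ t in a..b, g t) * (d + ∫ t in a..b, h t) - c * d := by
  have hF := absolutelyContinuousOnInterval_const_add c hg.absolutelyContinuousOnInterval_integral
  have hH := absolutelyContinuousOnInterval_const_add d hh.absolutelyContinuousOnInterval_integral
  have hint : IntervalIntegrable (fun x => g x * (d + ∫ t in a..x, h t) +
      (c + ∫ t in a..x, g t) * h x) volume a b :=
    (hg.mul_continuousOn hH.continuousOn).add (hh.continuousOn_mul hF.continuousOn)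
  -- The product minus the primitive of its a.e. derivative is absolutely continuous with a.e. zero
  -- derivative, hence constant; comparing the endpoints gives the formula.
  have hP := (hF.smul hH).sub hint.absolutelyContinuousOnInterval_integral
  obtain ⟨C, hC⟩ := hP.const_of_ae_hasDerivAt_zero (by
    filter_upwards [hg.ae_hasDerivAt_integral, hh.ae_hasDerivAt_integral,
      hint.ae_hasDerivAt_integral] with x h1 h2 h3 hx
    have h4 := (((h1 hx a left_mem_uIcc).const_add c).mul ((h2 hx a left_mem_uIcc).const_add d)).sub
      (h3 hx a left_mem_uIcc)
    rw [sub_self] at h4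
    exact h4)
  have ha := hC a left_mem_uIcc
  have hb := hC b right_mem_uIcc
  simp only [Pi.sub_apply, smul_eq_mul, Pi.mul_apply, intervalIntegral.integral_same, add_zero,
    sub_zero] at ha hb
  linear_combination ha - hb

variable {ℓ : ℝ}

theorem setIntegral_Ioo_eq (hℓ : 0 < ℓ) (f : ℝ → ℂ) :
    ∫ x in Ioo 0 ℓ, f x = ∫ x in 0..ℓ, f x := by
  rw [intervalIntegral.integral_of_le hℓ.le, integral_Ioc_eq_integral_Ioo]

namespace IntervalL2

theorem integrableOn (f : IntervalL2 ℓ) : IntegrableOn f (Ioo 0 ℓ) :=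
  (Lp.memLp f).integrable (by norm_num)

theorem intervalIntegrable (hℓ : 0 < ℓ) (f : IntervalL2 ℓ) : IntervalIntegrable f volume 0 ℓ :=
  (intervalIntegrable_iff_integrableOn_Ioo_of_le hℓ.le).2 f.integrableOn

theorem inner_eq (f g : IntervalL2 ℓ) :
    inner ℂ f g = ∫ x in Ioo 0 ℓ, g x * starRingEnd ℂ (f x) := rfl

theorem continuousOn_primitive (hℓ : 0 < ℓ) (g : IntervalL2 ℓ) (c : ℂ) :
    ContinuousOn (fun x => c + ∫ t in 0..x, g t) (Icc 0 ℓ) := by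
  have := (absolutelyContinuousOnInterval_const_add c
    (g.intervalIntegrable hℓ).absolutelyContinuousOnInterval_integral).continuousOn
  rwa [uIcc_of_le hℓ.le] at this

/-- The class in `L²(0, ℓ)` of a continuous function. -/
def ofContinuous (ℓ : ℝ) (F : ℝ → ℂ) (hF : Continuous F) : IntervalL2 ℓ :=
  MemLp.toLp (μ := volume.restrict (Ioo 0 ℓ)) (p := 2) F (by
    obtain ⟨C, hC⟩ := (isCompact_Icc (a := (0 : ℝ)) (b := ℓ)).exists_bound_of_continuousOn
      hF.continuousOn
    refine MemLp.of_bound hF.aestronglyMeasurable C ?_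
    filter_upwards [ae_restrict_mem measurableSet_Ioo] with x hx
    exact hC x (Ioo_subset_Icc_self hx))

theorem coeFn_ofContinuous {F : ℝ → ℂ} (hF : Continuous F) :
    ofContinuous ℓ F hF =ᵐ[volume.restrict (Ioo 0 ℓ)] F :=
  MemLp.coeFn_toLp _

theorem inner_ofContinuous {F : ℝ → ℂ} (hF : Continuous F) (g : IntervalL2 ℓ) :
    inner ℂ (ofContinuous ℓ F hF) g = ∫ x in Ioo 0 ℓ, g x * starRingEnd ℂ (F x) := by
  rw [inner_eq]
  refine integral_congr_ae ?_
  filter_upwards [coeFn_ofContinuous (ℓ := ℓ) hF] with x hx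
  rw [hx]

theorem inner_ofContinuous_ofReal {φ : ℝ → ℝ} (hφ : Continuous φ) (g : IntervalL2 ℓ) :
    inner ℂ (ofContinuous ℓ (fun x => (φ x : ℂ)) (Complex.continuous_ofReal.comp hφ)) g =
      ∫ x in Ioo 0 ℓ, φ x • g x := by
  rw [inner_ofContinuous]
  refine integral_congr_ae (Eventually.of_forall fun x => ?_)
  simp only [Complex.conj_ofReal, Complex.real_smul, mul_comm]

end IntervalL2

/-- Two representatives continuous on `[0, ℓ]` that agree a.e. agree everywhere, endpoints included.
-/
theorem HasBoundaryValues.unique (hℓ : 0 < ℓ) {f : IntervalL2 ℓ} {a b a' b' : ℂ}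
    (h : HasBoundaryValues f a b) (h' : HasBoundaryValues f a' b') : a = a' ∧ b = b' := by
  obtain ⟨F, hF, hf, rfl, rfl⟩ := h
  obtain ⟨F', hF', hf', rfl, rfl⟩ := h'
  have h1 : F =ᵐ[volume.restrict (Icc 0 ℓ)] F' := by
    rw [← Measure.restrict_congr_set Ioo_ae_eq_Icc]
    exact hf.symm.trans hf'
  have h2 := Measure.eqOn_Icc_of_ae_eq volume hℓ.ne h1 hF hF'
  exact ⟨h2 ⟨le_rfl, hℓ.le⟩, h2 ⟨hℓ.le, le_rfl⟩⟩

theorem hasBoundaryValues_of_ae_eq_primitive (hℓ : 0 < ℓ) {f g : IntervalL2 ℓ} {c : ℂ}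
    (h : f =ᵐ[volume.restrict (Ioo 0 ℓ)] fun x => c + ∫ t in 0..x, g t) :
    HasBoundaryValues f c (c + ∫ t in 0..ℓ, g t) :=
  ⟨_, g.continuousOn_primitive hℓ c, h, by simp, rfl⟩

/-- Integration by parts against `φ`, seen as the primitive of `φ'`; the boundary terms vanish with
`φ 0` and `φ ℓ`. -/
theorem hasWeakDeriv_of_ae_eq_primitive (hℓ : 0 < ℓ) {f g : IntervalL2 ℓ} {c : ℂ}
    (h : f =ᵐ[volume.restrict (Ioo 0 ℓ)] fun x => c + ∫ t in 0..x, g t) : HasWeakDeriv f g := by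
  intro φ hφ hc hs
  have hd : Continuous (deriv φ) := hφ.continuous_deriv (by simp)
  have hφ0 : ∀ x, x ∉ Ioo 0 ℓ → φ x = 0 := fun x hx =>
    image_eq_zero_of_notMem_tsupport fun hx' => hx (hs hx')
  have hprim : ∀ x, (φ x : ℂ) = 0 + ∫ t in 0..x, ((deriv φ t : ℝ) : ℂ) := fun x => by
    rw [intervalIntegral.integral_ofReal, intervalIntegral.integral_deriv_eq_sub
      (fun t _ => (hφ.differentiable (by simp)) t) (hd.intervalIntegrable _ _),
      hφ0 0 (by simp), sub_zero, zero_add]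
  have key := integral_primitive_mul_primitive (a := 0) (b := ℓ) (g := g)
    (h := fun t => ((deriv φ t : ℝ) : ℂ)) (g.intervalIntegrable hℓ)
    ((Complex.continuous_ofReal.comp hd).intervalIntegrable _ _) c 0
  simp only [← hprim] at key
  rw [hφ0 ℓ (by simp), ← setIntegral_Ioo_eq hℓ] at key
  have e : ∫ x in Ioo 0 ℓ, deriv φ x • f x =
      ∫ x in Ioo 0 ℓ, ((g x * (φ x : ℂ) + (c + ∫ t in 0..x, g t) * ((deriv φ x : ℝ) : ℂ)) -
        φ x • g x) := by
    refine integral_congr_ae ?_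
    filter_upwards [h] with x hx
    rw [hx]
    simp only [Complex.real_smul]
    ring
  have hfi : Integrable (fun x => g x * (φ x : ℂ) +
      (c + ∫ t in 0..x, g t) * ((deriv φ x : ℝ) : ℂ)) (volume.restrict (Ioo 0 ℓ)) := by
    have h1 := (integrable_test_smul g hφ.continuous hc).add
      (integrable_test_smul f hd hc.deriv)
    refine h1.congr ?_
    filter_upwards [h] with x hx
    rw [Pi.add_apply, hx]
    simp only [Complex.real_smul]
    ring
  rw [e, integral_sub hfi (integrable_test_smul g hφ.continuous hc), key]
  simp

/-- The du Bois-Reymond lemma. -/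
theorem ae_eq_const_of_integral_deriv_smul_eq_zero (hℓ : 0 < ℓ) {k : ℝ → ℂ}
    (hk : IntegrableOn k (Ioo 0 ℓ)) (h : ∀ φ : ℝ → ℝ, ContDiff ℝ ∞ φ → HasCompactSupport φ →
      tsupport φ ⊆ Ioo 0 ℓ → ∫ x in Ioo 0 ℓ, deriv φ x • k x = 0) :
    ∃ c : ℂ, k =ᵐ[volume.restrict (Ioo 0 ℓ)] fun _ => c := by
  obtain ⟨ψ₀, hψ₀, hψ₀c, hψ₀s, hψ₀1⟩ : ∃ ψ : ℝ → ℝ, ContDiff ℝ ∞ ψ ∧ HasCompactSupport ψ ∧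
      tsupport ψ ⊆ Ioo 0 ℓ ∧ ∫ x, ψ x = 1 := by
    let b : ContDiffBump (ℓ / 2) := ⟨ℓ / 8, ℓ / 4, by positivity, by linarith⟩
    refine ⟨b.normed volume, b.contDiff_normed, b.hasCompactSupport_normed, ?_, b.integral_normed⟩
    rw [b.tsupport_normed_eq, Real.closedBall_eq_Icc]
    intro x hx
    change ℓ / 2 - ℓ / 4 ≤ x ∧ x ≤ ℓ / 2 + ℓ / 4 at hx
    constructor <;> linarith [hx.1, hx.2]
  have hsmul : ∀ ψ : ℝ → ℝ, Continuous ψ → HasCompactSupport ψ →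
      IntegrableOn (fun x => ψ x • k x) (Ioo 0 ℓ) := fun ψ hψ hc => by
    obtain ⟨C, hC⟩ := hc.exists_bound_of_continuous hψ
    exact (show Integrable k _ from hk).bdd_smul C hψ.aestronglyMeasurable (Eventually.of_forall hC)
  have hset : ∀ {E : Type} [NormedAddCommGroup E] [NormedSpace ℝ E] (ψ : ℝ → ℝ) (F : ℝ → E),
      tsupport ψ ⊆ Ioo 0 ℓ → ∫ x in Ioo 0 ℓ, ψ x • F x = ∫ x, ψ x • F x := fun ψ F hs =>
    setIntegral_eq_integral_of_forall_compl_eq_zero fun x hx => by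
      rw [image_eq_zero_of_notMem_tsupport (fun hx' => hx (hs hx')), zero_smul]
  let c : ℂ := ∫ x in Ioo 0 ℓ, ψ₀ x • k x
  have hkc : IntegrableOn (fun x => k x - c) (Ioo 0 ℓ) :=
    Integrable.sub hk (integrableOn_const (by simp))
  have key := isOpen_Ioo.ae_eq_zero_of_integral_contDiff_smul_eq_zero (μ := volume)
    hkc.locallyIntegrableOn (by
      intro ψ hψ hψc hψs
      rw [← hset ψ _ hψs]
      -- Subtracting `m ψ₀` makes the integral zero, so the primitive `φ` of `η` is again a test
      -- function. Its hypothesis then reads `∫ ψ (k - c) = 0`.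
      let m : ℝ := ∫ x, ψ x
      let η : ℝ → ℝ := fun x => ψ x - m * ψ₀ x
      have hη : ContDiff ℝ ∞ η := hψ.sub (contDiff_const.mul hψ₀)
      have hηs : tsupport η ⊆ tsupport ψ ∪ tsupport ψ₀ := by
        refine closure_minimal (fun x hx => ?_) ((isClosed_tsupport _).union (isClosed_tsupport _))
        by_contra hx'
        rw [mem_union, not_or] at hx'
        refine hx ?_
        simp only [η, image_eq_zero_of_notMem_tsupport hx'.1,
          image_eq_zero_of_notMem_tsupport hx'.2, mul_zero, sub_zero]
      have hηc : HasCompactSupport η :=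
        (hψc.isCompact.union hψ₀c.isCompact).of_isClosed_subset (isClosed_tsupport _) hηs
      have hηi : ∫ x, η x = 0 := by
        rw [integral_sub (hψ.continuous.integrable_of_hasCompactSupport hψc)
          ((hψ₀.continuous.integrable_of_hasCompactSupport hψ₀c).const_mul m),
          integral_const_mul, hψ₀1, mul_one, sub_self]
      let φ : ℝ → ℝ := fun x => ∫ t in 0..x, η t
      have hφd : ∀ x, HasDerivAt φ (η x) x := fun x =>
        intervalIntegral.integral_hasDerivAt_right (hη.continuous.intervalIntegrable _ _)
          hη.continuous.aestronglyMeasurable.stronglyMeasurableAtFilter hη.continuous.continuousAt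
      have hφ' : deriv φ = η := funext fun x => (hφd x).deriv
      have hφ : ContDiff ℝ ∞ φ :=
        contDiff_infty_iff_deriv.2 ⟨fun x => (hφd x).differentiableAt, by rwa [hφ']⟩
      obtain ⟨p, q, hp, hq, hpq⟩ : ∃ p q : ℝ, 0 < p ∧ q < ℓ ∧ tsupport η ⊆ Icc p q := by
        -- The extra point `ℓ / 2` keeps the set nonempty even if `η = 0`, so that extremal elements
        -- exist.
        have hK : IsCompact (insert (ℓ / 2) (tsupport η)) := hηc.isCompact.insert _
        have hKs : insert (ℓ / 2) (tsupport η) ⊆ Ioo 0 ℓ :=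
          insert_subset ⟨by positivity, by linarith⟩ (hηs.trans (union_subset hψs hψ₀s))
        obtain ⟨p, hp⟩ := hK.exists_isLeast (insert_nonempty _ _)
        obtain ⟨q, hq⟩ := hK.exists_isGreatest (insert_nonempty _ _)
        exact ⟨p, q, (hKs hp.1).1, (hKs hq.1).2,
          fun x hx => ⟨hp.2 (mem_insert_of_mem _ hx), hq.2 (mem_insert_of_mem _ hx)⟩⟩
      have hη0 : ∀ x, x ∉ Icc p q → η x = 0 := fun x hx =>
        image_eq_zero_of_notMem_tsupport fun hx' => hx (hpq hx')
      have hφs : tsupport φ ⊆ Icc p q := by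
        refine closure_minimal (fun x hx => ?_) isClosed_Icc
        by_contra hx'
        refine hx ?_
        rcases not_and_or.1 hx' with hx' | hx'
        · have : ∀ t ∈ uIcc 0 x, η t = 0 := fun t ht => hη0 t fun htp => by
            rcases le_total 0 x with h0 | h0
            · rw [uIcc_of_le h0] at ht
              linarith [ht.2, htp.1]
            · rw [uIcc_of_ge h0] at ht
              linarith [ht.2, htp.1]
          simp only [φ, intervalIntegral.integral_congr this, intervalIntegral.integral_zero]
        · rw [not_le] at hx'
          by_cases hx0 : x ≤ 0
          · have : ∀ t ∈ uIcc 0 x, η t = 0 := fun t ht => hη0 t fun htp => by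
              rw [uIcc_of_ge hx0] at ht
              linarith [ht.2, htp.1]
            simp only [φ, intervalIntegral.integral_congr this, intervalIntegral.integral_zero]
          · simp only [φ]
            rw [intervalIntegral.integral_eq_integral_of_support_subset, hηi]
            intro t ht
            by_contra htx
            refine ht (hη0 t fun htp => htx ⟨by linarith [htp.1], by linarith [htp.2]⟩)
      have hIcc : Icc p q ⊆ Ioo 0 ℓ := fun x hx => ⟨hp.trans_le hx.1, hx.2.trans_lt hq⟩
      have h0 := h φ hφ (isCompact_Icc.of_isClosed_subset (isClosed_tsupport _) hφs)
        (hφs.trans hIcc)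
      have e1 : ∫ x in Ioo 0 ℓ, η x • k x = (∫ x in Ioo 0 ℓ, ψ x • k x) - m • c := by
        have hi : IntegrableOn (fun x => m • ψ₀ x • k x) (Ioo 0 ℓ) :=
          (hsmul ψ₀ hψ₀.continuous hψ₀c).smul m
        rw [← integral_smul, ← integral_sub (hsmul ψ hψ.continuous hψc) hi]
        refine integral_congr_ae (Eventually.of_forall fun x => ?_)
        simp only [η, sub_smul, mul_smul]
      have e2 : ∫ x in Ioo 0 ℓ, ψ x • (k x - c) = (∫ x in Ioo 0 ℓ, ψ x • k x) - m • c := by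
        have hm : ∫ x in Ioo 0 ℓ, ψ x • c = m • c := by
          rw [hset ψ _ hψs, integral_smul_const]
        have hi : IntegrableOn (fun x => ψ x • c) (Ioo 0 ℓ) :=
          ((hψ.continuous.integrable_of_hasCompactSupport hψc).smul_const c).integrableOn
        rw [← hm, ← integral_sub (hsmul ψ hψ.continuous hψc) hi]
        simp only [smul_sub]
      rw [e2, ← e1, ← hφ', h0])
  refine ⟨c, ?_⟩
  rw [EventuallyEq, ae_restrict_iff' measurableSet_Ioo]
  filter_upwards [key] with x hx hx'
  exact sub_eq_zero.1 (hx hx')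


/-- Subtracting the primitive of `g` leaves a function with weak derivative zero, which is constant
by du Bois-Reymond. -/
theorem HasWeakDeriv.exists_ae_eq_primitive (hℓ : 0 < ℓ) {f g : IntervalL2 ℓ}
    (h : HasWeakDeriv f g) :
    ∃ c : ℂ, f =ᵐ[volume.restrict (Ioo 0 ℓ)] fun x => c + ∫ t in 0..x, g t := by
  let P : ℝ → ℂ := fun x => 0 + ∫ t in 0..x, g t
  have hP : ContinuousOn P (Icc 0 ℓ) := g.continuousOn_primitive hℓ 0
  obtain ⟨C, hC⟩ := isCompact_Icc.exists_bound_of_continuousOn hP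
  have hPm : MemLp P 2 (volume.restrict (Ioo 0 ℓ)) := by
    refine MemLp.of_bound ((hP.mono Ioo_subset_Icc_self).aestronglyMeasurable measurableSet_Ioo)
      C ?_
    filter_upwards [ae_restrict_mem measurableSet_Ioo] with x hx
    exact hC x (Ioo_subset_Icc_self hx)
  have hPae : hPm.toLp P =ᵐ[volume.restrict (Ioo 0 ℓ)] P := hPm.coeFn_toLp
  have hPw : HasWeakDeriv (hPm.toLp P) g := hasWeakDeriv_of_ae_eq_primitive hℓ (c := 0) hPae
  have hz : HasWeakDeriv (f - hPm.toLp P) 0 := by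
    have := h.add (hPw.smul (-1))
    simpa [← sub_eq_add_neg] using this
  obtain ⟨c, hc⟩ := ae_eq_const_of_integral_deriv_smul_eq_zero hℓ
    (f - hPm.toLp P).integrableOn (fun φ hφ hφc hφs => by
      rw [hz φ hφ hφc hφs, neg_eq_zero, ← integral_zero ℝ ℂ (μ := volume.restrict (Ioo 0 ℓ))]
      refine integral_congr_ae ?_
      filter_upwards [Lp.coeFn_zero ℂ 2 (volume.restrict (Ioo 0 ℓ))] with x hx
      rw [hx, Pi.zero_apply, smul_zero])
  refine ⟨c, ?_⟩
  filter_upwards [hc, hPae, Lp.coeFn_sub f (hPm.toLp P)] with x h1 h2 h3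
  rw [h3, Pi.sub_apply, h2] at h1
  simp only [P] at h1
  linear_combination h1

theorem HasWeakDeriv.exists_hasBoundaryValues (hℓ : 0 < ℓ) {f g : IntervalL2 ℓ}
    (h : HasWeakDeriv f g) : ∃ a b, HasBoundaryValues f a b := by
  obtain ⟨c, hc⟩ := h.exists_ae_eq_primitive hℓ
  exact ⟨_, _, hasBoundaryValues_of_ae_eq_primitive hℓ hc⟩

theorem HasWeakDeriv.ae_eq_primitive (hℓ : 0 < ℓ) {f g : IntervalL2 ℓ} {a b : ℂ}
    (h : HasWeakDeriv f g) (hb : HasBoundaryValues f a b) :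
    (f =ᵐ[volume.restrict (Ioo 0 ℓ)] fun x => a + ∫ t in 0..x, g t) ∧
      b = a + ∫ t in 0..ℓ, g t := by
  obtain ⟨c, hc⟩ := h.exists_ae_eq_primitive hℓ
  obtain ⟨rfl, rfl⟩ := hb.unique hℓ (hasBoundaryValues_of_ae_eq_primitive hℓ hc)
  exact ⟨hc, rfl⟩

/-- Green's formula on an interval. -/
theorem HasWeakDeriv.inner_add_inner (hℓ : 0 < ℓ) {f g f' g' : IntervalL2 ℓ} {a b a' b' : ℂ}
    (h : HasWeakDeriv f g) (hb : HasBoundaryValues f a b)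
    (h' : HasWeakDeriv f' g') (hb' : HasBoundaryValues f' a' b') :
    inner ℂ g' f + inner ℂ f' g = starRingEnd ℂ b' * b - starRingEnd ℂ a' * a := by
  obtain ⟨h1, h2⟩ := h.ae_eq_primitive hℓ hb
  obtain ⟨h1', h2'⟩ := h'.ae_eq_primitive hℓ hb'
  have hconj : ∀ x, starRingEnd ℂ (a' + ∫ t in 0..x, g' t) =
      starRingEnd ℂ a' + ∫ t in 0..x, starRingEnd ℂ (g' t) := fun x => by
    rw [map_add]
    congr 1
    simp only [intervalIntegral, map_sub, ← integral_conj]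
  have hgi := g.intervalIntegrable hℓ
  have hgi' := g'.intervalIntegrable hℓ
  have hgc : IntervalIntegrable (fun t => starRingEnd ℂ (g' t)) volume 0 ℓ := by
    rw [intervalIntegrable_iff] at hgi' ⊢
    exact (Complex.conjLIE.toContinuousLinearEquiv.integrable_comp_iff).2 hgi'
  have key := integral_primitive_mul_primitive hgi hgc a (starRingEnd ℂ a')
  simp only [← hconj] at key
  rw [← h2, ← h2', ← setIntegral_Ioo_eq hℓ] at key
  rw [IntervalL2.inner_eq, IntervalL2.inner_eq, ← integral_add (L2.integrable_inner g' f)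
    (L2.integrable_inner f' g)]
  rw [mul_comm _ b, mul_comm _ a, ← key]
  refine integral_congr_ae ?_
  filter_upwards [h1, h1'] with x hx hx'
  rw [hx, hx']
  ring

namespace IntervalL2

theorem ae_eq_primitive_ofContinuous {F F' : ℝ → ℂ} (hF : Continuous F) (hF' : Continuous F')
    (hd : ∀ x, HasDerivAt F (F' x) x) :
    ofContinuous ℓ F hF =ᵐ[volume.restrict (Ioo 0 ℓ)]
      fun x => F 0 + ∫ t in 0..x, ofContinuous ℓ F' hF' t := by
  filter_upwards [coeFn_ofContinuous (ℓ := ℓ) hF, ae_restrict_mem measurableSet_Ioo] with x hx hx'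
  have h1 : ∫ t in 0..x, ofContinuous ℓ F' hF' t = ∫ t in 0..x, F' t := by
    refine intervalIntegral.integral_congr_ae ?_
    filter_upwards [(ae_restrict_iff' measurableSet_Ioo).1 (coeFn_ofContinuous (ℓ := ℓ) hF')]
      with t ht ht'
    rw [uIoc_of_le hx'.1.le] at ht'
    exact ht ⟨ht'.1, ht'.2.trans_lt hx'.2⟩
  rw [hx, h1, intervalIntegral.integral_eq_sub_of_hasDerivAt (fun t _ => hd t)
    (hF'.intervalIntegrable _ _)]
  ring

theorem hasWeakDeriv_ofContinuous (hℓ : 0 < ℓ) {F F' : ℝ → ℂ} (hF : Continuous F)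
    (hF' : Continuous F') (hd : ∀ x, HasDerivAt F (F' x) x) :
    HasWeakDeriv (ofContinuous ℓ F hF) (ofContinuous ℓ F' hF') :=
  hasWeakDeriv_of_ae_eq_primitive hℓ (ae_eq_primitive_ofContinuous hF hF' hd)

theorem hasBoundaryValues_ofContinuous {F : ℝ → ℂ} (hF : Continuous F) :
    HasBoundaryValues (ofContinuous ℓ F hF) (F 0) (F ℓ) :=
  ⟨F, hF.continuousOn, coeFn_ofContinuous hF, rfl, rfl⟩

/-- The class in `L²(0, ℓ)` of a real-valued continuous function. -/
def ofReal (ℓ : ℝ) (φ : ℝ → ℝ) (hφ : Continuous φ) : IntervalL2 ℓ :=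
  ofContinuous ℓ (fun x => (φ x : ℂ)) (Complex.continuous_ofReal.comp hφ)

theorem inner_ofReal {φ : ℝ → ℝ} (hφ : Continuous φ) (g : IntervalL2 ℓ) :
    inner ℂ (ofReal ℓ φ hφ) g = ∫ x in Ioo 0 ℓ, φ x • g x :=
  inner_ofContinuous_ofReal hφ g

theorem hasWeakDeriv_ofReal (hℓ : 0 < ℓ) {φ φ' : ℝ → ℝ} (hφ : Continuous φ)
    (hφ' : Continuous φ') (hd : ∀ x, HasDerivAt φ (φ' x) x) :
    HasWeakDeriv (ofReal ℓ φ hφ) (ofReal ℓ φ' hφ') :=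
  hasWeakDeriv_ofContinuous hℓ _ _ fun x => (hd x).ofReal_comp

theorem hasBoundaryValues_ofReal {φ : ℝ → ℝ} (hφ : Continuous φ) :
    HasBoundaryValues (ofReal ℓ φ hφ) (φ 0) (φ ℓ) :=
  hasBoundaryValues_ofContinuous _

/-- An element of `L²(0, ℓ)` that is orthogonal to all test functions vanishes. -/
theorem eq_zero_of_inner_test (f : IntervalL2 ℓ)
    (h : ∀ (φ : ℝ → ℝ) (hφ : ContDiff ℝ ∞ φ), HasCompactSupport φ → tsupport φ ⊆ Ioo 0 ℓ →
      inner ℂ (ofReal ℓ φ hφ.continuous) f = 0) : f = 0 := by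
  -- Orthogonality to all test functions says that `f` is a weak derivative of `0`.
  refine (HasWeakDeriv.unique (f := 0) (g := f) (fun φ hφ hc hs => ?_) hasWeakDeriv_zero)
  have h1 := hasWeakDeriv_zero (ℓ := ℓ) φ hφ hc hs
  rw [← inner_ofReal hφ.continuous, inner_zero_right, neg_zero] at h1
  rw [h1, ← inner_ofReal hφ.continuous, h φ hφ hc hs, neg_zero]

end IntervalL2

/-- Written with `L²` inner products, each tested identity is visibly a closed condition on `(f,
g)`. -/
theorem hasWeakDeriv_iff_inner {f g : IntervalL2 ℓ} : HasWeakDeriv f g ↔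
    ∀ (φ : ℝ → ℝ) (hφ : ContDiff ℝ ∞ φ), HasCompactSupport φ → tsupport φ ⊆ Ioo 0 ℓ →
      inner ℂ (IntervalL2.ofReal ℓ (deriv φ) (hφ.continuous_deriv (by simp))) f +
        inner ℂ (IntervalL2.ofReal ℓ φ hφ.continuous) g = 0 := by
  simp only [IntervalL2.inner_ofReal, add_eq_zero_iff_eq_neg]
  rfl

theorem isClosed_hasWeakDeriv :
    IsClosed {p : IntervalL2 ℓ × IntervalL2 ℓ | HasWeakDeriv p.1 p.2} := by
  simp only [hasWeakDeriv_iff_inner, ofPred_forall]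
  refine isClosed_iInter fun φ => isClosed_iInter fun hφ => isClosed_iInter fun _ =>
    isClosed_iInter fun _ => isClosed_eq (by fun_prop) continuous_const

/-- The boundary values of `f ∈ W^{1,2}(0, ℓ)` as continuous functionals of `(f, f')`. -/
theorem HasWeakDeriv.boundaryValues_eq (hℓ : 0 < ℓ) {f g : IntervalL2 ℓ} {a b : ℂ}
    (h : HasWeakDeriv f g) (hb : HasBoundaryValues f a b) :
    a = (ℓ : ℂ)⁻¹ * (inner ℂ (IntervalL2.ofReal ℓ (fun _ => 1) continuous_const) f -
        inner ℂ (IntervalL2.ofReal ℓ (fun x => ℓ - x) (by fun_prop)) g) ∧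
      b = (ℓ : ℂ)⁻¹ * (inner ℂ (IntervalL2.ofReal ℓ (fun _ => 1) continuous_const) f +
        inner ℂ (IntervalL2.ofReal ℓ (fun x => x) continuous_id) g) := by
  have hℓ' : (ℓ : ℂ) ≠ 0 := by exact_mod_cast hℓ.ne'
  -- Green's formula against `x` isolates the value at `ℓ`, and against `ℓ - x` the value at `0`,
  -- each with weight `ℓ`.
  have h1 := h.inner_add_inner hℓ hb
    (IntervalL2.hasWeakDeriv_ofReal hℓ continuous_id continuous_const hasDerivAt_id)
    (IntervalL2.hasBoundaryValues_ofReal continuous_id)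
  have h2 := h.inner_add_inner hℓ hb
    (IntervalL2.hasWeakDeriv_ofReal hℓ (φ := fun x => ℓ - x) (φ' := fun _ => -1) (by fun_prop)
      continuous_const fun x => by simpa using (hasDerivAt_id x).const_sub ℓ)
    (IntervalL2.hasBoundaryValues_ofReal (by fun_prop))
  have h3 : inner ℂ (IntervalL2.ofReal ℓ (fun _ => -1) continuous_const) f =
      -inner ℂ (IntervalL2.ofReal ℓ (fun _ => 1) continuous_const) f := by
    simp only [IntervalL2.inner_ofReal, neg_smul, integral_neg]
  rw [h3] at h2
  simp only [id, Complex.conj_ofReal, sub_zero, sub_self, Complex.ofReal_zero, zero_mul,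
    zero_sub, map_zero] at h1 h2
  change _ + inner ℂ (IntervalL2.ofReal ℓ (fun x => x) continuous_id) g = _ at h1
  rw [eq_inv_mul_iff_mul_eq₀ hℓ', eq_inv_mul_iff_mul_eq₀ hℓ']
  exact ⟨by linear_combination h2, by linear_combination -h1⟩

end Interval

/-! ### Green's formula, weak solutions and the Dirichlet form on a metric graph. -/

section Graph

namespace MetricGraph

variable {V : Type*} (G : MetricGraph V)

theorem D_spec {u : G.L2} (hu : u ∈ G.D.domain) (e : G.edges) :
    HasWeakDeriv (u e) (G.D ⟨u, hu⟩ e) :=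
  hu.choose_spec e

theorem D_eq {u g : G.L2} (hu : u ∈ G.D.domain) (h : ∀ e, HasWeakDeriv (u e) (g e)) :
    G.D ⟨u, hu⟩ = g :=
  PiLp.ext fun e => (G.D_spec hu e).unique (h e)

/-- An explicit witness `g` for the first derivative replaces the chosen value of `D` and its nested
membership proofs. -/
theorem mem_graph_negSecondDeriv {u k : G.L2} : (u, k) ∈ G.negSecondDeriv.graph ↔
    ∃ g : G.L2, (∀ e, HasWeakDeriv (u e) (g e)) ∧ ∀ e, HasWeakDeriv (g e) (-k e) := by
  rw [LinearPMap.mem_graph_iff]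
  constructor
  · rintro ⟨⟨w, hw, hw'⟩, hwu, hwk⟩
    simp only at hwu hwk
    subst hwu
    refine ⟨G.D ⟨w, hw⟩, G.D_spec hw, fun e => ?_⟩
    have h1 := G.D_spec hw' e
    replace hwk : -G.D ⟨G.D ⟨w, hw⟩, hw'⟩ = k := hwk
    rw [← hwk, PiLp.neg_apply, neg_neg]
    exact h1
  · rintro ⟨g, hg, hk⟩
    have hu : u ∈ G.D.domain := ⟨g, hg⟩
    have hk' : ∀ e, HasWeakDeriv (g e) ((-k : G.L2) e) := hk
    have hDu := G.D_eq hu hg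
    have hg' : g ∈ G.D.domain := ⟨-k, hk'⟩
    refine ⟨⟨u, hu, by rw [hDu]; exact hg'⟩, rfl, ?_⟩
    change -G.D ⟨G.D ⟨u, hu⟩, _⟩ = k
    simp only [hDu]
    rw [G.D_eq hg' hk', neg_neg]

end MetricGraph

theorem LinearPMap.mem_graph_domRestrict {H : Type*} [AddCommGroup H] [Module ℂ H]
    {f : H →ₗ.[ℂ] H} {S : Submodule ℂ H} {u k : H} :
    (u, k) ∈ (f.domRestrict S).graph ↔ u ∈ S ∧ (u, k) ∈ f.graph := by
  rw [mem_graph_iff, mem_graph_iff]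
  constructor
  · rintro ⟨⟨w, hwS, hwf⟩, rfl, rfl⟩
    exact ⟨hwS, ⟨w, hwf⟩, rfl, rfl⟩
  · rintro ⟨hS, ⟨w, hwf⟩, rfl, rfl⟩
    exact ⟨⟨w, hS, hwf⟩, rfl, rfl⟩

namespace MetricGraph

variable {V : Type*} (G : MetricGraph V)

theorem mem_neumannCondition {u g : G.L2} (h : ∀ e, HasWeakDeriv (u e) (g e)) :
    u ∈ G.neumannCondition ↔ ∀ e, HasBoundaryValues (g e) 0 0 := by
  have hu : u ∈ G.D.domain := ⟨g, h⟩
  have hDu := G.D_eq hu h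
  constructor
  · rintro ⟨_, h1⟩
    rwa [hDu] at h1
  · intro h1
    exact ⟨hu, by rwa [hDu]⟩

theorem mem_kirchhoffCondition {u g : G.L2} (h : ∀ e, HasWeakDeriv (u e) (g e)) :
    u ∈ G.kirchhoffCondition ↔ ∃ p q : G.edges → ℂ, (∀ e, HasBoundaryValues (g e) (p e) (q e)) ∧
      ∀ v : V, ∑ e, G.incPlus v e * q e - ∑ e, G.incMinus v e * p e = 0 := by
  have hu : u ∈ G.D.domain := ⟨g, h⟩
  have hDu := G.D_eq hu h
  constructor
  · rintro ⟨_, h1⟩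
    rwa [hDu] at h1
  · intro h1
    exact ⟨hu, by rwa [hDu]⟩

theorem mem_graph_negLaplacianCont {u k : G.L2} : (u, k) ∈ G.negLaplacianCont.graph ↔
    ∃ (g : G.L2) (d : V → ℂ), (∀ e, HasWeakDeriv (u e) (g e)) ∧
      (∀ e, HasWeakDeriv (g e) (-k e)) ∧ (∀ e, HasBoundaryValues (u e) (d e.1.1) (d e.1.2)) ∧
      ∀ e, HasBoundaryValues (g e) 0 0 := by
  unfold negLaplacianCont
  rw [LinearPMap.mem_graph_domRestrict, mem_graph_negSecondDeriv]
  constructor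
  · rintro ⟨⟨⟨d, hd⟩, hn⟩, g, hg, hk⟩
    exact ⟨g, d, hg, hk, hd, (G.mem_neumannCondition hg).1 hn⟩
  · rintro ⟨g, d, hg, hk, hd, hn⟩
    exact ⟨⟨⟨d, hd⟩, (G.mem_neumannCondition hg).2 hn⟩, g, hg, hk⟩

theorem mem_graph_negLaplacianKirchhoff {u k : G.L2} :
    (u, k) ∈ G.negLaplacianKirchhoff.graph ↔
    ∃ (g : G.L2) (d : V → ℂ) (p q : G.edges → ℂ), (∀ e, HasWeakDeriv (u e) (g e)) ∧
      (∀ e, HasWeakDeriv (g e) (-k e)) ∧ (∀ e, HasBoundaryValues (u e) (d e.1.1) (d e.1.2)) ∧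
      (∀ e, HasBoundaryValues (g e) (p e) (q e)) ∧
      ∀ v : V, ∑ e, G.incPlus v e * q e - ∑ e, G.incMinus v e * p e = 0 := by
  unfold negLaplacianKirchhoff
  rw [LinearPMap.mem_graph_domRestrict, mem_graph_negSecondDeriv]
  constructor
  · rintro ⟨⟨⟨d, hd⟩, hn⟩, g, hg, hk⟩
    obtain ⟨p, q, hpq, hs⟩ := (G.mem_kirchhoffCondition hg).1 hn
    exact ⟨g, d, p, q, hg, hk, hd, hpq, hs⟩
  · rintro ⟨g, d, p, q, hg, hk, hd, hpq, hs⟩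
    exact ⟨⟨⟨d, hd⟩, (G.mem_kirchhoffCondition hg).2 ⟨p, q, hpq, hs⟩⟩, g, hg, hk⟩

theorem negLaplacianCont_le_negLaplacianKirchhoff :
    G.negLaplacianCont ≤ G.negLaplacianKirchhoff := by
  refine LinearPMap.le_of_le_graph ?_
  rintro ⟨u, k⟩ h
  obtain ⟨g, d, hg, hk, hd, hn⟩ := G.mem_graph_negLaplacianCont.1 h
  exact G.mem_graph_negLaplacianKirchhoff.2 ⟨g, d, 0, 0, hg, hk, hd, hn, fun v => by simp⟩

/-- The edgewise derivative on `W^{1,2}(𝔊)`. -/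
def gradient : G.L2 →ₗ.[ℂ] G.L2 where
  domain := G.W12
  toFun := G.D.toFun ∘ₗ Submodule.inclusion inf_le_left

theorem mem_graph_gradient {u g : G.L2} : (u, g) ∈ G.gradient.graph ↔
    (∀ e, HasWeakDeriv (u e) (g e)) ∧
      ∃ d : V → ℂ, ∀ e, HasBoundaryValues (u e) (d e.1.1) (d e.1.2) := by
  rw [LinearPMap.mem_graph_iff]
  constructor
  · rintro ⟨⟨w, hw, hd⟩, hwu, hwg⟩
    simp only at hwu hwg
    subst hwu
    rw [← hwg]
    exact ⟨G.D_spec hw, hd⟩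
  · rintro ⟨h, hd⟩
    exact ⟨⟨u, ⟨g, h⟩, hd⟩, rfl, G.D_eq ⟨g, h⟩ h⟩

theorem dirichletForm_eq (u v : G.W12) :
    G.dirichletForm.toFun u v = inner ℂ (G.gradient v) (G.gradient u) := rfl

/-- Green's formula on a metric graph. -/
theorem inner_add_inner {u g u' g' : G.L2} {a b a' b' : G.edges → ℂ}
    (h : ∀ e, HasWeakDeriv (u e) (g e)) (hb : ∀ e, HasBoundaryValues (u e) (a e) (b e))
    (h' : ∀ e, HasWeakDeriv (u' e) (g' e)) (hb' : ∀ e, HasBoundaryValues (u' e) (a' e) (b' e)) :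
    inner ℂ g' u + inner ℂ u' g =
      ∑ e, (starRingEnd ℂ (b' e) * b e - starRingEnd ℂ (a' e) * a e) := by
  rw [PiLp.inner_apply, PiLp.inner_apply, ← Finset.sum_add_distrib]
  exact Finset.sum_congr rfl fun e _ =>
    (h e).inner_add_inner (G.length_pos e) (hb e) (h' e) (hb' e)

/-- Each edge contributes only at its two endpoints, so weighting the Kirchhoff sums by node values
gives the boundary sum in Green's formula. -/
theorem sum_mul_incidence [Fintype V] (c : V → ℂ) (p q : G.edges → ℂ) :
    ∑ v, c v * (∑ e, G.incPlus v e * q e - ∑ e, G.incMinus v e * p e) =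
      ∑ e : G.edges, (c e.1.2 * q e - c e.1.1 * p e) := by
  simp only [mul_sub, Finset.sum_sub_distrib, Finset.mul_sum]
  rw [Finset.sum_comm, Finset.sum_comm (γ := V) (f := fun v e => c v * (G.incMinus v e * p e))]
  congr 1
  · refine Finset.sum_congr rfl fun e _ => ?_
    rw [Finset.sum_eq_single e.1.2 (fun v _ hv => by simp [incPlus, hv]) (by simp)]
    simp [incPlus]
  · refine Finset.sum_congr rfl fun e _ => ?_
    rw [Finset.sum_eq_single e.1.1 (fun v _ hv => by simp [incMinus, hv]) (by simp)]
    simp [incMinus]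

/-- The boundary terms are the Kirchhoff sums of `u` weighted by the conjugate node values of `w`,
and therefore vanish. -/
theorem inner_eq_of_mem_graph [Finite V] {u k : G.L2}
    (h : (u, k) ∈ G.negLaplacianKirchhoff.graph) :
    ∃ hu : u ∈ G.W12, ∀ w : G.W12,
      inner ℂ (w : G.L2) k = inner ℂ (G.gradient w) (G.gradient ⟨u, hu⟩) := by
  have := Fintype.ofFinite V
  obtain ⟨g, d, p, q, hg, hk, hd, hpq, hs⟩ := G.mem_graph_negLaplacianKirchhoff.1 h
  have hu : u ∈ G.W12 := ⟨⟨g, hg⟩, d, hd⟩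
  refine ⟨hu, fun w => ?_⟩
  obtain ⟨hw, dw, hdw⟩ := G.mem_graph_gradient.1 (G.gradient.mem_graph w)
  have hgu : G.gradient ⟨u, hu⟩ = g := G.D_eq hu.1 hg
  have hk' : ∀ e, HasWeakDeriv (g e) ((-k : G.L2) e) := hk
  have h1 := G.inner_add_inner hk' hpq hw hdw
  rw [← G.sum_mul_incidence (fun v => starRingEnd ℂ (dw v))] at h1
  simp only [hs, mul_zero, Finset.sum_const_zero, inner_neg_right] at h1
  rw [hgu]
  linear_combination -h1

open Classical in
/-- The function that equals `f` on the edge `e` and vanishes on all other edges. -/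
def single (e : G.edges) (f : IntervalL2 (G.length e)) : G.L2 :=
  WithLp.toLp 2 (Pi.single e f)

theorem single_same (e : G.edges) (f : IntervalL2 (G.length e)) : G.single e f e = f := by
  simp [single]

theorem single_of_ne {e e' : G.edges} (h : e' ≠ e) (f : IntervalL2 (G.length e)) :
    G.single e f e' = 0 := by
  simp [single, h]

theorem inner_single (e : G.edges) (f : IntervalL2 (G.length e)) (u : G.L2) :
    inner ℂ (G.single e f) u = inner ℂ f (u e) := by
  rw [PiLp.inner_apply, Finset.sum_eq_single e]
  · rw [single_same]
  · intro e' _ h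
    rw [G.single_of_ne h, inner_zero_left]
  · simp

theorem hasWeakDeriv_single {e : G.edges} {f g : IntervalL2 (G.length e)} (h : HasWeakDeriv f g)
    (e' : G.edges) : HasWeakDeriv (G.single e f e') (G.single e g e') := by
  by_cases he : e' = e
  · subst he
    rwa [single_same, single_same]
  · rw [G.single_of_ne he, G.single_of_ne he]
    exact hasWeakDeriv_zero

theorem hasBoundaryValues_single {e : G.edges} {f : IntervalL2 (G.length e)}
    (h : HasBoundaryValues f 0 0) (e' : G.edges) : HasBoundaryValues (G.single e f e') 0 0 := by
  by_cases he : e' = e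
  · subst he
    rwa [single_same]
  · rw [G.single_of_ne he]
    exact hasBoundaryValues_zero

/-- A bump inside one edge, extended by zero, has vanishing endpoint values and derivatives. Such
functions yield both the differential equation and the density of the domain. -/
theorem exists_mem_graph_test (e : G.edges) {φ : ℝ → ℝ} (hφ : ContDiff ℝ ∞ φ)
    (hs : tsupport φ ⊆ Ioo 0 (G.length e)) :
    ∃ k, (G.single e (IntervalL2.ofReal (G.length e) φ hφ.continuous), k) ∈
        G.negLaplacianCont.graph ∧
      (G.single e (IntervalL2.ofReal (G.length e) φ hφ.continuous),
        G.single e (IntervalL2.ofReal (G.length e) (deriv φ) (hφ.continuous_deriv (by simp)))) ∈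
        G.gradient.graph := by
  have hℓ := G.length_pos e
  have hφ1 : ContDiff ℝ ∞ (deriv φ) := (contDiff_infty_iff_deriv.1 hφ).2
  have hφ2 : ContDiff ℝ ∞ (deriv (deriv φ)) := (contDiff_infty_iff_deriv.1 hφ1).2
  have hs1 : tsupport (deriv φ) ⊆ Ioo 0 (G.length e) := tsupport_deriv_subset.trans hs
  have hw1 := IntervalL2.hasWeakDeriv_ofReal hℓ hφ.continuous hφ1.continuous
    fun x => ((hφ.differentiable (by simp)) x).hasDerivAt
  have hw2 := IntervalL2.hasWeakDeriv_ofReal hℓ hφ1.continuous hφ2.continuous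
    fun x => ((hφ1.differentiable (by simp)) x).hasDerivAt
  have hbv : ∀ {ψ : ℝ → ℝ} (hψ : Continuous ψ), tsupport ψ ⊆ Ioo 0 (G.length e) →
      HasBoundaryValues (IntervalL2.ofReal (G.length e) ψ hψ) 0 0 := fun {ψ} hψ hsψ => by
    have h0 : ψ 0 = 0 := image_eq_zero_of_notMem_tsupport fun h => by simpa using hsψ h
    have h1 : ψ (G.length e) = 0 := image_eq_zero_of_notMem_tsupport fun h => by simpa using hsψ h
    simpa [h0, h1] using IntervalL2.hasBoundaryValues_ofReal (ℓ := G.length e) hψ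
  refine ⟨-G.single e (IntervalL2.ofReal (G.length e) _ hφ2.continuous),
    G.mem_graph_negLaplacianCont.2 ⟨_, 0, G.hasWeakDeriv_single hw1, fun e' => ?_,
      G.hasBoundaryValues_single (hbv _ hs), G.hasBoundaryValues_single (hbv _ hs1)⟩,
    G.mem_graph_gradient.2 ⟨G.hasWeakDeriv_single hw1, 0,
      G.hasBoundaryValues_single (hbv _ hs)⟩⟩
  rw [PiLp.neg_apply, neg_neg]
  exact G.hasWeakDeriv_single hw2 e'

end MetricGraph

/-- The smooth transition attains its global minimum at `0` and, in the companion lemma, its global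
maximum at `1`. -/
theorem deriv_smoothTransition_zero : deriv Real.smoothTransition 0 = 0 :=
  IsLocalMin.deriv_eq_zero (Eventually.of_forall fun x => by
    rw [Real.smoothTransition.zero]
    exact Real.smoothTransition.nonneg x)

theorem deriv_smoothTransition_one : deriv Real.smoothTransition 1 = 0 :=
  IsLocalMax.deriv_eq_zero (Eventually.of_forall fun x => by
    rw [Real.smoothTransition.one]
    exact Real.smoothTransition.le_one x)

/-- A function on `(0, ℓ)` with given boundary values whose derivative vanishes at the endpoints. -/
theorem exists_hasBoundaryValues_deriv_zero {ℓ : ℝ} (hℓ : 0 < ℓ) (a b : ℝ) :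
    ∃ f g h : IntervalL2 ℓ, HasWeakDeriv f g ∧ HasWeakDeriv g h ∧ HasBoundaryValues f a b ∧
      HasBoundaryValues g 0 0 := by
  -- The interpolant is `a + (b - a) S(x / ℓ)`, which is flat at both ends.
  let S := Real.smoothTransition
  have hS : ContDiff ℝ ∞ S := Real.smoothTransition.contDiff
  have hS1 : ContDiff ℝ ∞ (deriv S) := (contDiff_infty_iff_deriv.1 hS).2
  have hS2 : ContDiff ℝ ∞ (deriv (deriv S)) := (contDiff_infty_iff_deriv.1 hS1).2
  have hd1 : ∀ x, HasDerivAt (fun x => a + (b - a) * S (x / ℓ))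
      ((b - a) * (deriv S (x / ℓ) * (1 / ℓ))) x := fun x =>
    ((((hS.differentiable (by simp)) (x / ℓ)).hasDerivAt.comp x
      ((hasDerivAt_id x).div_const ℓ)).const_mul (b - a)).const_add a
  have hd2 : ∀ x, HasDerivAt (fun x => (b - a) * (deriv S (x / ℓ) * (1 / ℓ)))
      ((b - a) * ((deriv (deriv S) (x / ℓ) * (1 / ℓ)) * (1 / ℓ))) x := fun x =>
    ((((hS1.differentiable (by simp)) (x / ℓ)).hasDerivAt.comp x
      ((hasDerivAt_id x).div_const ℓ)).mul_const (1 / ℓ)).const_mul (b - a)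
  have c0 := hS.continuous
  have c1 := hS1.continuous
  have c2 := hS2.continuous
  have hc : Continuous fun x : ℝ => x / ℓ := by fun_prop
  refine ⟨IntervalL2.ofReal ℓ (fun x => a + (b - a) * S (x / ℓ)) (by fun_prop),
    IntervalL2.ofReal ℓ (fun x => (b - a) * (deriv S (x / ℓ) * (1 / ℓ)))
      (((c1.comp hc).mul continuous_const).const_mul _),
    IntervalL2.ofReal ℓ (fun x => (b - a) * ((deriv (deriv S) (x / ℓ) * (1 / ℓ)) * (1 / ℓ)))
      ((((c2.comp hc).mul continuous_const).mul continuous_const).const_mul _),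
    IntervalL2.hasWeakDeriv_ofReal hℓ _ _ hd1, IntervalL2.hasWeakDeriv_ofReal hℓ _ _ hd2, ?_, ?_⟩
  · convert IntervalL2.hasBoundaryValues_ofReal (ℓ := ℓ) _ using 1
    · simp [S]
    · simp [S, hℓ.ne']
  · convert IntervalL2.hasBoundaryValues_ofReal (ℓ := ℓ) _ using 1
    · simp [S, deriv_smoothTransition_zero]
    · simp [S, hℓ.ne', deriv_smoothTransition_one]

namespace MetricGraph

variable {V : Type*} (G : MetricGraph V)

/-- Vanishing end derivatives do not restrict the node values, so the domain of `-Δ_cont` can probe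
(Kc) at each node separately. -/
theorem exists_mem_graph_nodeValues (d : V → ℝ) : ∃ w k g : G.L2,
    (w, k) ∈ G.negLaplacianCont.graph ∧ (∀ e, HasWeakDeriv (w e) (g e)) ∧
      ∀ e, HasBoundaryValues (w e) (d e.1.1) (d e.1.2) := by
  choose f g h hfg hgh hf hg using fun e : G.edges =>
    exists_hasBoundaryValues_deriv_zero (G.length_pos e) (d e.1.1) (d e.1.2)
  refine ⟨WithLp.toLp 2 f, -WithLp.toLp 2 h, WithLp.toLp 2 g,
    G.mem_graph_negLaplacianCont.2 ⟨WithLp.toLp 2 g, fun v => d v, hfg, fun e => ?_, hf, hg⟩,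
    hfg, hf⟩
  rw [PiLp.neg_apply, neg_neg]
  exact hgh e

theorem domain_negLaplacianCont_le : G.negLaplacianCont.domain ≤ G.W12 := fun u hu => by
  obtain ⟨g, d, hg, -, hd, -⟩ := G.mem_graph_negLaplacianCont.1
    (G.negLaplacianCont.mem_graph ⟨u, hu⟩)
  exact ⟨⟨g, hg⟩, d, hd⟩

/-- A weak solution in `W^{1,2}(𝔊)`, tested with the domain of `-Δ_cont`, is a strong solution. -/
theorem mem_graph_of_weak {u : G.W12} {k : G.L2} (h : ∀ w : G.negLaplacianCont.domain,
    inner ℂ (w : G.L2) k =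
      inner ℂ (G.gradient (Submodule.inclusion G.domain_negLaplacianCont_le w)) (G.gradient u)) :
    ((u : G.L2), k) ∈ G.negLaplacianKirchhoff.graph := by
  have h' : ∀ w g m : G.L2, (w, m) ∈ G.negLaplacianCont.graph →
      (∀ e, HasWeakDeriv (w e) (g e)) → inner ℂ w k = inner ℂ g (G.gradient u) := by
    intro w g m hm hwg
    obtain ⟨w', rfl, -⟩ := (LinearPMap.mem_graph_iff _).1 hm
    have h1 := h w'
    have h2 : G.gradient (Submodule.inclusion G.domain_negLaplacianCont_le w') = g :=
      G.D_eq (G.domain_negLaplacianCont_le w'.2).1 hwg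
    rwa [h2] at h1
  obtain ⟨hu, d, hd⟩ := G.mem_graph_gradient.1 (G.gradient.mem_graph u)
  simp only at hu hd
  have hk : ∀ e, HasWeakDeriv (G.gradient u e) ((-k : G.L2) e) := fun e => by
    -- Bumps in the edge `e` turn the weak equation into the statement that the weak derivative of
    -- `u'` is `-k`.
    rw [hasWeakDeriv_iff_inner]
    intro φ hφ _ hs
    obtain ⟨m, hm, hgr⟩ := G.exists_mem_graph_test e hφ hs
    have h1 := h' _ _ m hm (G.mem_graph_gradient.1 hgr).1
    rw [inner_single, inner_single] at h1
    rw [PiLp.neg_apply, inner_neg_right, h1, add_neg_cancel]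
  choose p q hpq using fun e => (hk e).exists_hasBoundaryValues (G.length_pos e)
  refine G.mem_graph_negLaplacianKirchhoff.2 ⟨G.gradient u, d, p, q, hu, hk, hd, hpq, fun v => ?_⟩
  classical
  -- With node values the indicator of `v`, Green's formula leaves only the Kirchhoff sum at `v`,
  -- and the weak equation makes it zero.
  obtain ⟨w, m, g, hm, hwg, hwd⟩ := G.exists_mem_graph_nodeValues (Pi.single v 1)
  have h1 := G.inner_add_inner hk hpq hwg hwd
  rw [inner_neg_right, h' w g m hm hwg, add_neg_cancel] at h1
  rw [← Finset.sum_sub_distrib, h1]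
  refine Finset.sum_congr rfl fun e _ => ?_
  simp only [incPlus, incMinus, Pi.single_apply, eq_comm (a := v)]
  split_ifs <;> simp

/-- The derivative on `W^{1,2}(𝔊)` is a closed operator. -/
theorem isClosed_gradient [Finite V] : G.gradient.IsClosed := by
  -- `A` and `B` are the initial and terminal values as continuous functionals of `(u, u')`. (Cc)
  -- says that they lie in the range of `R`, a subspace of a finite-dimensional space and hence
  -- closed.
  let A (e : G.edges) (x : G.L2 × G.L2) : ℂ := ((G.length e : ℝ) : ℂ)⁻¹ *
    (inner ℂ (IntervalL2.ofReal (G.length e) (fun _ => 1) continuous_const) (x.1 e) -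
      inner ℂ (IntervalL2.ofReal (G.length e) (fun t => G.length e - t) (by fun_prop)) (x.2 e))
  let B (e : G.edges) (x : G.L2 × G.L2) : ℂ := ((G.length e : ℝ) : ℂ)⁻¹ *
    (inner ℂ (IntervalL2.ofReal (G.length e) (fun _ => 1) continuous_const) (x.1 e) +
      inner ℂ (IntervalL2.ofReal (G.length e) (fun t => t) continuous_id) (x.2 e))
  let R : (V → ℂ) →ₗ[ℂ] (G.edges → ℂ × ℂ) :=
    { toFun := fun d e => (d e.1.1, d e.1.2)
      map_add' := fun _ _ => rfl
      map_smul' := fun _ _ => rfl }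
  have hgraph : (G.gradient.graph : Set (G.L2 × G.L2)) =
      (⋂ e, (fun x : G.L2 × G.L2 => (x.1 e, x.2 e)) ⁻¹' {p | HasWeakDeriv p.1 p.2}) ∩
        (fun x e => (A e x, B e x)) ⁻¹' (LinearMap.range R : Set (G.edges → ℂ × ℂ)) := by
    ext ⟨u, g⟩
    refine (G.mem_graph_gradient).trans ?_
    simp only [mem_inter_iff, mem_iInter, mem_preimage, mem_ofPred_eq, SetLike.mem_coe,
      LinearMap.mem_range]
    refine and_congr_right fun h => exists_congr fun d => ?_
    have hb : ∀ e a b, HasBoundaryValues (u e) a b ↔ a = A e (u, g) ∧ b = B e (u, g) := by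
      intro e a b
      refine ⟨fun hab => (h e).boundaryValues_eq (G.length_pos e) hab, ?_⟩
      rintro ⟨rfl, rfl⟩
      obtain ⟨a, b, hab⟩ := (h e).exists_hasBoundaryValues (G.length_pos e)
      obtain ⟨h1, h2⟩ := (h e).boundaryValues_eq (G.length_pos e) hab
      change a = A e (u, g) at h1
      change b = B e (u, g) at h2
      rwa [← h1, ← h2]
    simp only [hb, funext_iff, Prod.ext_iff]
    rfl
  unfold LinearPMap.IsClosed
  rw [hgraph]
  refine IsClosed.inter (isClosed_iInter fun e => isClosed_hasWeakDeriv.preimage (by fun_prop)) ?_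
  exact (Submodule.closed_of_finiteDimensional _).preimage (by fun_prop)

theorem dense_domain_negLaplacianCont : Dense (G.negLaplacianCont.domain : Set G.L2) := by
  rw [Submodule.dense_iff_topologicalClosure_eq_top,
    Submodule.topologicalClosure_eq_top_iff, Submodule.eq_bot_iff]
  intro f hf
  refine PiLp.ext fun e => IntervalL2.eq_zero_of_inner_test _ fun φ hφ _ hs => ?_
  obtain ⟨m, hm, -⟩ := G.exists_mem_graph_test e hφ hs
  obtain ⟨w, hw, -⟩ := (LinearPMap.mem_graph_iff _).1 hm
  have h1 := (Submodule.mem_orthogonal _ _).1 hf w w.2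
  simp only at hw
  rwa [hw, inner_single] at h1

theorem dirichletForm_isPositive : G.dirichletForm.IsPositive :=
  ⟨fun u v => (inner_conj_symm (𝕜 := ℂ) (G.gradient v) (G.gradient u)).symm,
    fun u => inner_self_nonneg (𝕜 := ℂ) (x := G.gradient u)⟩

theorem dirichletForm_self (u : G.W12) :
    G.dirichletForm.toFun u u = ((‖G.gradient u‖ ^ 2 : ℝ) : ℂ) := by
  rw [dirichletForm_eq, inner_self_eq_norm_sq_to_K]
  norm_cast

theorem tendsto_dirichletForm_sub {x : ℕ → G.W12} {u : G.W12}
    (h : Tendsto (fun n => G.gradient (x n)) atTop (𝓝 (G.gradient u))) :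
    Tendsto (fun n => G.dirichletForm.toFun (x n - u) (x n - u)) atTop (𝓝 0) := by
  have h1 := (tendsto_iff_norm_sub_tendsto_zero.1 h).pow 2
  rw [zero_pow two_ne_zero] at h1
  have h2 := (Complex.continuous_ofReal.tendsto 0).comp h1
  rw [Complex.ofReal_zero] at h2
  refine h2.congr fun n => ?_
  have h3 : G.gradient (x n - u) = G.gradient (x n) - G.gradient u := G.gradient.map_sub _ _
  refine Eq.trans ?_ (G.dirichletForm_self (x n - u)).symm
  rw [h3]
  rfl

/-- Cauchy for the form means that the derivatives are Cauchy in `L²`; closedness of `gradient`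
identifies their limit as the derivative of `u`. -/
theorem dirichletForm_isClosed [Finite V] : G.dirichletForm.IsClosed := by
  intro x u hu hx
  have hcau : CauchySeq fun n => G.gradient (x n) := by
    rw [Metric.cauchySeq_iff]
    intro ε hε
    obtain ⟨N, hN⟩ := hx (ε ^ 2) (by positivity)
    refine ⟨N, fun m hm n hn => ?_⟩
    have h1 := hN m hm n hn
    have h2 : G.gradient (x m - x n) = G.gradient (x m) - G.gradient (x n) :=
      G.gradient.map_sub _ _
    have h3 := G.dirichletForm_self (x m - x n)
    rw [h3, Complex.ofReal_re, h2] at h1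
    rw [dist_eq_norm]
    exact lt_of_pow_lt_pow_left₀ 2 hε.le h1
  obtain ⟨g, hg⟩ := cauchySeq_tendsto_of_complete hcau
  have hgr : (u, g) ∈ G.gradient.graph :=
    G.isClosed_gradient.mem_of_tendsto (hu.prodMk_nhds hg)
      (Eventually.of_forall fun n => G.gradient.mem_graph (x n))
  obtain ⟨v, hv, hv'⟩ := (LinearPMap.mem_graph_iff _).1 hgr
  simp only at hv hv'
  subst hv
  refine ⟨v.2, G.tendsto_dirichletForm_sub (u := v) ?_⟩
  rwa [hv']

theorem dirichletForm_isAssociated [Finite V] :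
    G.dirichletForm.IsAssociated G.negLaplacianKirchhoff := by
  intro u k
  constructor
  · exact G.inner_eq_of_mem_graph
  · rintro ⟨hu, h⟩
    exact G.mem_graph_of_weak (u := ⟨u, hu⟩) fun w =>
      h (Submodule.inclusion G.domain_negLaplacianCont_le w)

theorem dirichletForm_isClosureOf [Finite V] :
    G.dirichletForm.IsClosureOf G.negLaplacianCont.toForm := by
  refine ⟨G.dirichletForm_isPositive, G.dirichletForm_isClosed, G.domain_negLaplacianCont_le,
    fun u v => ?_, fun u => ?_⟩
  · obtain ⟨hu, h⟩ := G.inner_eq_of_mem_graph (LinearPMap.le_graph_of_le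
      G.negLaplacianCont_le_negLaplacianKirchhoff (G.negLaplacianCont.mem_graph u))
    exact (h (Submodule.inclusion G.domain_negLaplacianCont_le v)).symm
  · obtain ⟨x, hx, hx'⟩ := G.isClosed_gradient.exists_seq_of_orthogonal
      G.domain_negLaplacianCont_le (fun v hv => by
        -- Form-orthogonality to Dom(A) is the weak equation with right-hand side `-v`. Testing the
        -- resulting strong solution with `v` gives -‖v‖² = ‖v'‖² ≥ 0.
        have h1 := G.mem_graph_of_weak (u := v) (k := -v) fun w => by
          rw [inner_neg_right]
          exact neg_eq_of_add_eq_zero_right (hv w)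
        obtain ⟨_, h2⟩ := G.inner_eq_of_mem_graph h1
        have h3 := congrArg Complex.re (h2 v)
        rw [inner_neg_right, Complex.neg_re] at h3
        have h4 : 0 ≤ (inner ℂ (G.gradient v) (G.gradient v)).re :=
          inner_self_nonneg (𝕜 := ℂ) (x := G.gradient v)
        have h5 : (inner ℂ (v : G.L2) (v : G.L2)).re = ‖(v : G.L2)‖ ^ 2 :=
          inner_self_eq_norm_sq (𝕜 := ℂ) (v : G.L2)
        have h6 : ‖(v : G.L2)‖ ^ 2 ≤ 0 := by
          have : -‖(v : G.L2)‖ ^ 2 = (inner ℂ (G.gradient v) (G.gradient v)).re := by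
            rw [← h5]; exact h3
          linarith
        exact Subtype.ext (norm_eq_zero.1 (pow_eq_zero_iff two_ne_zero |>.1
          (le_antisymm h6 (by positivity))))) u
    exact ⟨x, hx, G.tendsto_dirichletForm_sub hx'⟩

theorem dense_W12 : Dense (G.W12 : Set G.L2) :=
  G.dense_domain_negLaplacianCont.mono G.domain_negLaplacianCont_le

theorem negLaplacianKirchhoff_inner [Finite V] (u v : G.negLaplacianKirchhoff.domain) :
    ∃ (hu : (u : G.L2) ∈ G.W12) (hv : (v : G.L2) ∈ G.W12),
      inner ℂ (v : G.L2) (G.negLaplacianKirchhoff u) =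
        inner ℂ (G.gradient ⟨v, hv⟩) (G.gradient ⟨u, hu⟩) := by
  obtain ⟨hu, h⟩ := G.inner_eq_of_mem_graph (G.negLaplacianKirchhoff.mem_graph u)
  obtain ⟨hv, -⟩ := G.inner_eq_of_mem_graph (G.negLaplacianKirchhoff.mem_graph v)
  exact ⟨hu, hv, h ⟨v, hv⟩⟩

theorem negLaplacianKirchhoff_isPosSemidef [Finite V] :
    G.negLaplacianKirchhoff.IsPosSemidef := by
  constructor
  · intro u v
    obtain ⟨_, _, h1⟩ := G.negLaplacianKirchhoff_inner u v
    obtain ⟨_, _, h2⟩ := G.negLaplacianKirchhoff_inner v u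
    rw [h2, ← inner_conj_symm, h1, inner_conj_symm]
  · intro u
    obtain ⟨hu, _, h1⟩ := G.negLaplacianKirchhoff_inner u u
    rw [← inner_conj_symm, h1, Complex.conj_re]
    exact inner_self_nonneg (𝕜 := ℂ) (x := G.gradient ⟨u, hu⟩)

theorem negLaplacianKirchhoff_isSelfAdjoint [Finite V] :
    IsSelfAdjoint G.negLaplacianKirchhoff := by
  refine LinearPMap.isSelfAdjoint_of_surjective
    (G.dense_domain_negLaplacianCont.mono G.negLaplacianCont_le_negLaplacianKirchhoff.1)
    G.negLaplacianKirchhoff_isPosSemidef.1 fun f => ?_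
  obtain ⟨u, hu⟩ := G.isClosed_gradient.exists_weak_solution f
  -- The weak equation for `1 + A_F` with data `f` is the weak equation for `A_F` with data `f - u`.
  have h1 := G.mem_graph_of_weak (u := u) (k := f - u) fun w => by
    rw [inner_sub_right, sub_eq_iff_eq_add']
    exact hu (Submodule.inclusion G.domain_negLaplacianCont_le w)
  obtain ⟨v, hv, hv'⟩ := (LinearPMap.mem_graph_iff _).1 h1
  simp only at hv hv'
  exact ⟨v, by rw [hv, hv', add_sub_cancel]⟩

theorem negLaplacianCont_isPosSemidef [Finite V] : G.negLaplacianCont.IsPosSemidef := by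
  obtain ⟨hle, heq⟩ := G.negLaplacianCont_le_negLaplacianKirchhoff
  have h1 : ∀ u : G.negLaplacianCont.domain,
      G.negLaplacianCont u = G.negLaplacianKirchhoff ⟨u, hle u.2⟩ := fun u => heq rfl
  constructor
  · intro u v
    rw [h1, h1]
    exact G.negLaplacianKirchhoff_isPosSemidef.1 ⟨u, hle u.2⟩ ⟨v, hle v.2⟩
  · intro u
    rw [h1]
    exact G.negLaplacianKirchhoff_isPosSemidef.2 ⟨u, hle u.2⟩

end MetricGraph

end Graph

end

theorem mainTheorem5 {V : Type*} [Finite V] (G : MetricGraph V) :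
    G.negLaplacianCont.IsFriedrichsExtension G.negLaplacianKirchhoff ∧
    G.dirichletForm.IsClosureOf G.negLaplacianCont.toForm ∧
    G.dirichletForm.IsAssociated G.negLaplacianKirchhoff :=
  ⟨⟨G.dense_domain_negLaplacianCont, G.negLaplacianCont_isPosSemidef,
    G.negLaplacianCont_le_negLaplacianKirchhoff, G.negLaplacianKirchhoff_isSelfAdjoint,
    G.negLaplacianKirchhoff_isPosSemidef, fun _ hAC hC hp =>
      LinearPMap.formLE_of_isClosureOf G.dirichletForm_isClosureOf G.dense_W12
        G.dirichletForm_isAssociated hAC hC hp⟩,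
    G.dirichletForm_isClosureOf, G.dirichletForm_isAssociated⟩
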